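/- Consider infinitely many decision makers (DMs) indexed by $i\in\mathbb{N}$, with states $x_t^i\in\mathbb{R}^{n_x}$, controls $u_t^i\in\mathbb{R}^{n_u}$ and environment variables $y_t\in\mathbb{R}^{n_y}$, $t\in\mathbb{N}_0$, such that $$x_{t+1}^i=Ax_t^i+Bu_t^i+w_t^i,\qquad y_t=\limsup_{\bar N\to\infty}\frac1{\bar N}\sum_{j=1}^{\bar N}\big(E^1u_t^j+E^2x_t^j\big)+\xi_t$$ (the limsup is taken coordinatewise). The stage cost is $c(x,u,y)=x'Qx+u'Ru+2y'(Ku+Lx)$ with $Q\succ0$, $R\succ0$, and costs are discounted by $\beta\in[0,1)$. A pure strategy $s^i=(s^i_t)_{t\ge0}$ of DM$^i$ is a sequence of measurable maps giving $u_t^i=s_t^i(x_0^i,\dots,x_t^i,u_0^i,\dots,u_{t-1}^i,y_0,\dots,y_{t-1})$. For a deterministic sequence $\bar z=(\bar z_t)_{t\ge0}$ put $J^i(s^i,\bar z)=E\big[\sum_{t\ge0}\beta^tc(x_t^i,u_t^i,\bar z_t)\big]\in(-\infty,\infty]$, where the states and controls are generated by $s^i$ with $\bar z$ in place of $(y_t)_{t\ge0}$.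 A joint strategy $s=(s^i)_{i\in\mathbb{N}}$ is an SEBEU (subjective equilibrium under beliefs of exogenous uncertainty) if the environment variables it generates are almost surely well defined (finite) and there are probability measures $\zeta^i$ on $(\mathbb{R}^{n_y})^{\mathbb{N}_0}$, $i\in\mathbb{N}$, such that for every $i$: (i) $E^{\zeta^i}[J^i(\tilde s^i,\cdot)]$ is well defined for every pure strategy $\tilde s^i$, and $E^{\zeta^i}[J^i(s^i,\cdot)]\le E^{\zeta^i}[J^i(\tilde s^i,\cdot)]$; (ii) $\zeta^i$ is the law of the sequence $(y_t)_{t\ge0}$ generated by $s$. Assume that $(A,B)$ is stabilizable; that all the random vectors $x_0^i$, $w_t^i$, $\xi_t$ ($i\in\mathbb{N}$, $t\in\mathbb{N}_0$) are mutually independent with finite second moments; and that each of the families $(x_0^i)_i$, $(w_t^i)_{i,t}$, $(\xi_t)_t$ is identically distributed. Write $\hat w=E[w_0^1]$, $\hat\xi=E[\xi_0]$. Then the algebraic Riccati equation $$M=Q+\beta A'\big(M-\beta MBS^{-1}B'M\big)A,\qquad S=R+\beta B'MB,$$ has a unique positive semidefinite solution $M$, and the following constants are well defined (the series converges and the inverses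 exist): $$F=-\beta S^{-1}B'MA,\quad \Gamma=\beta(A+BF)',\quad H=-\beta S^{-1}B'(I-\Gamma)^{-1}M\hat w,$$ $$G=\sum_{n\ge0}G_n,\quad G_0=-S^{-1}K',\quad G_n=-\beta S^{-1}B'\,\Gamma^{\,n-1}(F'K'+L')\ \ (n\ge1).$$ Suppose that $(\hat y_0,\hat x_0)$ solves $$\hat y_0=(E^1F+E^2)\hat x_0+E^1G\hat y_0+E^1H+\hat\xi,\qquad \hat x_0=A\hat x_0+B(F\hat x_0+G\hat y_0+H)+\hat w,$$ and that $E[x_0^1]=\hat x_0$. Then the strategies $$u_t^i=Fx_t^i+G\hat y_0+H,\qquad i\in\mathbb{N},\ t\in\mathbb{N}_0,$$ form an SEBEU, and the environment variables $(y_t)_{t\ge0}$ which they generate are iid with finite second moments and mean $E[y_t]=\hat y_0$. -/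

import Mathlib

open MeasureTheory ProbabilityTheory Filter
open scoped ENNReal Matrix

namespace LQ

/-- Column vectors of length `n`, with their Borel sigma-algebra. -/
abbrev Vec (n : ℕ) : Type := Fin n → ℝ

/-- A pure strategy: at time `t` a measurable map of the own states `x_0, …, x_t`, the own
controls `u_0, …, u_{t-1}` and the environment variables `y_0, …, y_{t-1}` to a control. -/
structure Strategy (nx nu ny : ℕ) where
  act : ∀ t : ℕ, (Fin (t + 1) → Vec nx) × (Fin t → Vec nu) × (Fin t → Vec ny) → Vec nu
  measurable_act : ∀ t, Measurable (act t)

/-- A real square matrix is (Schur) stable: its complex eigenvalues lie in the open unit disc. -/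
def IsStable {n : ℕ} (A : Matrix (Fin n) (Fin n) ℝ) : Prop :=
  ∀ c ∈ spectrum ℂ (A.map (algebraMap ℝ ℂ)), ‖c‖ < 1

/-- `(A, B)` is stabilizable: some linear feedback makes the closed loop stable. -/
def IsStabilizable {n m : ℕ} (A : Matrix (Fin n) (Fin n) ℝ) (B : Matrix (Fin n) (Fin m) ℝ) : Prop :=
  ∃ F : Matrix (Fin m) (Fin n) ℝ, IsStable (A + B * F)

/-- The matrices and the discount factor common to all players. The own state dynamics are
`x_{t+1} = A x_t + B u_t + w_t` (the environment does not enter, i.e. `C = 0`), the stage cost is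
`x'Qx + u'Ru + 2y'(Ku + Lx)`, and `E1`, `E2` form the environment variable. -/
structure Game (nx nu ny : ℕ) where
  A : Matrix (Fin nx) (Fin nx) ℝ
  B : Matrix (Fin nx) (Fin nu) ℝ
  Q : Matrix (Fin nx) (Fin nx) ℝ
  R : Matrix (Fin nu) (Fin nu) ℝ
  K : Matrix (Fin ny) (Fin nu) ℝ
  L : Matrix (Fin ny) (Fin nx) ℝ
  E1 : Matrix (Fin ny) (Fin nu) ℝ
  E2 : Matrix (Fin ny) (Fin nx) ℝ
  β : ℝ

namespace Game

variable {nx nu ny : ℕ} (g : Game nx nu ny)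

/-- The stage cost. -/
def stageCost (x : Vec nx) (u : Vec nu) (y : Vec ny) : ℝ :=
  x ⬝ᵥ (g.Q *ᵥ x) + u ⬝ᵥ (g.R *ᵥ u) + 2 * (y ⬝ᵥ (g.K *ᵥ u + g.L *ᵥ x))

/-- State and control at time `t` of a player who uses `s`, starts at `x₀` and meets the
disturbances `w` and the environment sequence `z` (of which only `z_0, …, z_{t-1}` matter). -/
def path (s : Strategy nx nu ny) (x₀ : Vec nx) (w : ℕ → Vec nx) (z : ℕ → Vec ny) :
    ℕ → Vec nx × Vec nu
  | 0 => (x₀, s.act 0 (fun _ => x₀, fun k => k.elim0, fun k => k.elim0))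
  | t + 1 =>
    let x' := g.A *ᵥ (path s x₀ w z t).1 + g.B *ᵥ (path s x₀ w z t).2 + w t
    (x', s.act (t + 1)
      (Fin.snoc (α := fun _ => Vec nx) (fun k : Fin (t + 1) => (path s x₀ w z k).1) x',
        fun k : Fin (t + 1) => (path s x₀ w z k).2, fun k : Fin (t + 1) => z k))

/-- The state at time `t`. -/
def state (s : Strategy nx nu ny) (x₀ : Vec nx) (w : ℕ → Vec nx) (z : ℕ → Vec ny) (t : ℕ) :
    Vec nx := (g.path s x₀ w z t).1

/-- The control at time `t`. -/
def control (s : Strategy nx nu ny) (x₀ : Vec nx) (w : ℕ → Vec nx) (z : ℕ → Vec ny) (t : ℕ) :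
    Vec nu := (g.path s x₀ w z t).2

theorem state_zero (s : Strategy nx nu ny) (x₀ : Vec nx) (w : ℕ → Vec nx) (z : ℕ → Vec ny) :
    g.state s x₀ w z 0 = x₀ := by
  simp [state, path]

theorem state_succ (s : Strategy nx nu ny) (x₀ : Vec nx) (w : ℕ → Vec nx) (z : ℕ → Vec ny)
    (t : ℕ) : g.state s x₀ w z (t + 1) =
      g.A *ᵥ g.state s x₀ w z t + g.B *ᵥ g.control s x₀ w z t + w t := by
  simp [state, control, path]

theorem control_eq (s : Strategy nx nu ny) (x₀ : Vec nx) (w : ℕ → Vec nx) (z : ℕ → Vec ny)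
    (t : ℕ) : g.control s x₀ w z t =
      s.act t (fun k => g.state s x₀ w z k, fun k => g.control s x₀ w z k, fun k => z k) := by
  cases t with
  | zero =>
    simp only [control, path]
    congr 1
    refine Prod.ext ?_ (Prod.ext ?_ ?_)
    · funext k
      simp [state, path]
    · funext k; exact k.elim0
    · funext k; exact k.elim0
  | succ t =>
    have h : (Fin.snoc (α := fun _ => Vec nx) (fun k : Fin (t + 1) => (g.path s x₀ w z k).1)
        (g.state s x₀ w z (t + 1)) : Fin (t + 1 + 1) → Vec nx) =
        fun k : Fin (t + 1 + 1) => g.state s x₀ w z (k : ℕ) := by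
      funext k
      refine Fin.lastCases ?_ (fun k => ?_) k
      · simp
      · simp [state]
    rw [← h, control, path, state_succ]
    rfl

theorem path_congr (s : Strategy nx nu ny) (x₀ : Vec nx) (w : ℕ → Vec nx) (z z' : ℕ → Vec ny)
    (t : ℕ) (h : ∀ k < t, z k = z' k) : g.path s x₀ w z t = g.path s x₀ w z' t := by
  induction t using Nat.strong_induction_on with
  | _ t ih =>
    cases t with
    | zero => simp [path]
    | succ t =>
      have hp : ∀ k : Fin (t + 1), g.path s x₀ w z k = g.path s x₀ w z' k := fun k =>
        ih k k.2 fun j hj => h j (hj.trans k.2)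
      have hz : (fun k : Fin (t + 1) => z k) = fun k : Fin (t + 1) => z' k :=
        funext fun k => h k k.2
      have ht := hp (Fin.last t)
      simp only [Fin.val_last] at ht
      rw [path, path]
      simp only [hp, hz, ht]

/-- The average of `E1 u^j + E2 x^j` over the first `N` players. -/
noncomputable def average (x : ℕ → Vec nx) (u : ℕ → Vec nu) (N : ℕ) : Vec ny :=
  (N : ℝ)⁻¹ • ∑ j ∈ Finset.range N, (g.E1 *ᵥ u j + g.E2 *ᵥ x j)

/-- The limit superior of the averages, coordinate by coordinate, in the extended reals. -/
noncomputable def limsupAverage (x : ℕ → Vec nx) (u : ℕ → Vec nu) (k : Fin ny) : EReal :=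
  limsup (fun N : ℕ => ((g.average x u N k : ℝ) : EReal)) atTop

/-- The environment variables `y_t` generated by a joint strategy `s`: `y_t` is formed from the
states and controls at time `t`, which depend on `y_0, …, y_{t-1}` only. -/
noncomputable def env (s : ℕ → Strategy nx nu ny) (x₀ : ℕ → Vec nx) (w : ℕ → ℕ → Vec nx)
    (ξ : ℕ → Vec ny) (t : ℕ) : Vec ny :=
  let z : ℕ → Vec ny := fun k => if _h : k < t then env s x₀ w ξ k else 0
  (fun k => (g.limsupAverage (fun j => g.state (s j) (x₀ j) (w j) z t)
    (fun j => g.control (s j) (x₀ j) (w j) z t) k).toReal) + ξ t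
termination_by t

theorem env_eq (s : ℕ → Strategy nx nu ny) (x₀ : ℕ → Vec nx) (w : ℕ → ℕ → Vec nx)
    (ξ : ℕ → Vec ny) (t : ℕ) : g.env s x₀ w ξ t =
      (fun k => (g.limsupAverage (fun j => g.state (s j) (x₀ j) (w j) (g.env s x₀ w ξ) t)
        (fun j => g.control (s j) (x₀ j) (w j) (g.env s x₀ w ξ) t) k).toReal) + ξ t := by
  have h : ∀ j, g.path (s j) (x₀ j) (w j)
      (fun k => if _h : k < t then g.env s x₀ w ξ k else 0) t =
      g.path (s j) (x₀ j) (w j) (g.env s x₀ w ξ) t := fun j =>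
    g.path_congr _ _ _ _ _ t fun k hk => by simp [hk]
  rw [env]
  simp only [state, control, h]

end Game

/-- The sum of a real series as an extended real: sum of the positive parts minus sum of the
negative parts. -/
noncomputable def extSum (a : ℕ → ℝ) : EReal :=
  ((∑' t, ENNReal.ofReal (a t) : ℝ≥0∞) : EReal) - ((∑' t, ENNReal.ofReal (-a t) : ℝ≥0∞) : EReal)

/-- The expectation of an extended real random variable: expectation of the positive part minus
expectation of the negative part. -/
noncomputable def extExp {Ω : Type*} [MeasurableSpace Ω] (μ : Measure Ω) (X : Ω → EReal) : EReal :=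
  ((∫⁻ ω, (X ω).toENNReal ∂μ : ℝ≥0∞) : EReal) - ((∫⁻ ω, (-X ω).toENNReal ∂μ : ℝ≥0∞) : EReal)

namespace Game

variable {nx nu ny : ℕ} (g : Game nx nu ny) {Ω : Type*} [MeasurableSpace Ω]

/-- The discounted cost at time `t` of a player on one realization. -/
def discountedCost (s : Strategy nx nu ny) (x₀ : Vec nx) (w : ℕ → Vec nx) (z : ℕ → Vec ny)
    (t : ℕ) : ℝ :=
  g.β ^ t * g.stageCost (g.state s x₀ w z t) (g.control s x₀ w z t) (z t)

/-- The long-term cost `J(s, z)` of a player with initial state `x₀` and disturbances `w`, for a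
deterministic sequence `z` of environment variables. -/
noncomputable def cost (P : Measure Ω) (x₀ : Ω → Vec nx) (w : ℕ → Ω → Vec nx)
    (s : Strategy nx nu ny) (z : ℕ → Vec ny) : EReal :=
  extExp P fun ω => extSum (g.discountedCost s (x₀ ω) (fun t => w t ω) z)

/-- `E^ζ [J(s, ·)]`: the cost when the environment variables are believed to be an exogenous
sequence of law `ζ`, independent of the other primitive variables. -/
noncomputable def believedCost (P : Measure Ω) (x₀ : Ω → Vec nx) (w : ℕ → Ω → Vec nx)
    (ζ : Measure (ℕ → Vec ny)) (s : Strategy nx nu ny) : EReal :=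
  extExp ζ (g.cost P x₀ w s)

/-- The negative parts of the discounted costs have a finite total expectation, so that the series
and both expectations in `believedCost` are well defined, with values in `(-∞, ∞]`. -/
def CostDefined (P : Measure Ω) (x₀ : Ω → Vec nx) (w : ℕ → Ω → Vec nx)
    (ζ : Measure (ℕ → Vec ny)) (s : Strategy nx nu ny) : Prop :=
  ∫⁻ z, ∫⁻ ω, ∑' t, ENNReal.ofReal (-g.discountedCost s (x₀ ω) (fun t => w t ω) z t) ∂P ∂ζ ≠ ⊤

/-- The random environment variables generated by a joint strategy (`w i t` is the disturbance of
player `i` at time `t`). -/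
noncomputable def randomEnv (x₀ : ℕ → Ω → Vec nx) (w : ℕ → ℕ → Ω → Vec nx) (ξ : ℕ → Ω → Vec ny)
    (s : ℕ → Strategy nx nu ny) (t : ℕ) (ω : Ω) : Vec ny :=
  g.env s (fun i => x₀ i ω) (fun i k => w i k ω) (fun k => ξ k ω) t

/-- Almost surely, the limits superior which form the environment variables are finite. -/
def EnvDefined (P : Measure Ω) (x₀ : ℕ → Ω → Vec nx) (w : ℕ → ℕ → Ω → Vec nx)
    (ξ : ℕ → Ω → Vec ny) (s : ℕ → Strategy nx nu ny) : Prop :=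
  ∀ᵐ ω ∂P, ∀ (t : ℕ) (k : Fin ny),
    let y : ℕ → Vec ny := fun n => g.randomEnv x₀ w ξ s n ω
    let l := g.limsupAverage (fun j => g.state (s j) (x₀ j ω) (fun n => w j n ω) y t)
      (fun j => g.control (s j) (x₀ j ω) (fun n => w j n ω) y t) k
    l ≠ ⊥ ∧ l ≠ ⊤

/-- The joint strategy `s` is a subjective equilibrium under beliefs of exogenous uncertainty:
for some beliefs, each player's strategy is optimal for the player's belief, and each belief is the
law of the environment variables that `s` generates. -/
def IsSEBEU (P : Measure Ω) (x₀ : ℕ → Ω → Vec nx) (w : ℕ → ℕ → Ω → Vec nx) (ξ : ℕ → Ω → Vec ny)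
    (s : ℕ → Strategy nx nu ny) : Prop :=
  g.EnvDefined P x₀ w ξ s ∧
  ∃ ζ : ℕ → Measure (ℕ → Vec ny),
    (∀ i, IsProbabilityMeasure (ζ i)) ∧
    (∀ i, ∀ s' : Strategy nx nu ny, g.CostDefined P (x₀ i) (w i) (ζ i) s') ∧
    (∀ i, ∀ s' : Strategy nx nu ny,
      g.believedCost P (x₀ i) (w i) (ζ i) (s i) ≤ g.believedCost P (x₀ i) (w i) (ζ i) s') ∧
    ∀ i, ζ i = P.map fun ω t => g.randomEnv x₀ w ξ s t ω

/-- `S = R + β B'MB`. -/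
def S (M : Matrix (Fin nx) (Fin nx) ℝ) : Matrix (Fin nu) (Fin nu) ℝ :=
  g.R + g.β • (g.Bᵀ * M * g.B)

/-- `M` is a positive semidefinite solution of the algebraic Riccati equation. -/
def IsRiccatiSolution (M : Matrix (Fin nx) (Fin nx) ℝ) : Prop :=
  M.PosSemidef ∧
    M = g.Q + g.β • (g.Aᵀ * (M - g.β • (M * g.B * (g.S M)⁻¹ * g.Bᵀ * M)) * g.A)

/-- The feedback gain `F`. -/
noncomputable def F (M : Matrix (Fin nx) (Fin nx) ℝ) : Matrix (Fin nu) (Fin nx) ℝ :=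
  -(g.β • ((g.S M)⁻¹ * g.Bᵀ * M * g.A))

/-- `Γ = β (A + BF)'`. -/
noncomputable def Γ (M : Matrix (Fin nx) (Fin nx) ℝ) : Matrix (Fin nx) (Fin nx) ℝ :=
  g.β • (g.A + g.B * g.F M)ᵀ

/-- The weight `G_n` of the predicted environment variable `n` steps ahead. -/
noncomputable def Gseq (M : Matrix (Fin nx) (Fin nx) ℝ) : ℕ → Matrix (Fin nu) (Fin ny) ℝ
  | 0 => -((g.S M)⁻¹ * g.Kᵀ)
  | n + 1 => -(g.β • ((g.S M)⁻¹ * g.Bᵀ * (g.Γ M) ^ n * ((g.F M)ᵀ * g.Kᵀ + g.Lᵀ)))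

/-- `G`, the sum of the weights `G_n`. -/
noncomputable def G (M : Matrix (Fin nx) (Fin nx) ℝ) : Matrix (Fin nu) (Fin ny) ℝ :=
  ∑' n, g.Gseq M n

/-- The constant `H`, where `wbar` is the mean of the disturbances. -/
noncomputable def H (M : Matrix (Fin nx) (Fin nx) ℝ) (wbar : Vec nx) : Vec nu :=
  -(g.β • (((g.S M)⁻¹ * g.Bᵀ * (1 - g.Γ M)⁻¹ * M) *ᵥ wbar))

end Game

/-- The strategy `u_t = F x_t + h`. -/
def affineStrategy {nx nu : ℕ} (ny : ℕ) (F : Matrix (Fin nu) (Fin nx) ℝ) (h : Vec nu) :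
    Strategy nx nu ny where
  act t I := F *ᵥ I.1 (Fin.last t) + h
  measurable_act t := by
    refine Measurable.add_const ?_ h
    exact (Continuous.matrix_mulVec continuous_const
      ((continuous_apply (Fin.last t)).comp continuous_fst)).measurable

/-- The initial states `x₀ i`, the disturbances `w i t` and the noises `ξ t` are mutually
independent random vectors with finite second moments, and each of the three families is
identically distributed. -/
structure PrimitiveAssumption {Ω : Type*} [MeasurableSpace Ω] (P : Measure Ω) {nx ny : ℕ}
    (x₀ : ℕ → Ω → Vec nx) (w : ℕ → ℕ → Ω → Vec nx) (ξ : ℕ → Ω → Vec ny) : Prop where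
  measurable_x₀ : ∀ i, Measurable (x₀ i)
  measurable_w : ∀ i t, Measurable (w i t)
  measurable_ξ : ∀ t, Measurable (ξ t)
  memLp_x₀ : ∀ i, MemLp (x₀ i) 2 P
  memLp_w : ∀ i t, MemLp (w i t) 2 P
  memLp_ξ : ∀ t, MemLp (ξ t) 2 P
  indep : iIndep (Sum.elim (fun i : ℕ => MeasurableSpace.comap (x₀ i) inferInstance)
    (Sum.elim (fun p : ℕ × ℕ => MeasurableSpace.comap (w p.1 p.2) inferInstance)
      (fun t : ℕ => MeasurableSpace.comap (ξ t) inferInstance))) P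
  ident_x₀ : ∀ i, IdentDistrib (x₀ i) (x₀ 0) P P
  ident_w : ∀ i t, IdentDistrib (w i t) (w 0 0) P P
  ident_ξ : ∀ t, IdentDistrib (ξ t) (ξ 0) P P

end LQ

/-! The proof splits into a statement about the population and a control problem for a single
player.

Population. Put `h = G ŷ₀ + H`. Under `u = F x + h` the states at a fixed time are iid across
players. Their mean stays at `x̂₀`, which is a fixed point of the mean dynamics
(`integral_affineState`). The strong law (`tendsto_average`) turns the averages into the constant `c
= E1 (F x̂₀ + h) + E2 x̂₀`. Hence almost surely `y_t = c + ξ_t` for all `t`, an iid sequence whose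
mean is `ŷ₀` by the equation for `ŷ₀` (`randomEnv_ae_eq`). The common belief is therefore the law of
`(c + ξ_t)_t`.

Single player. Under this belief `y_t` is independent of `(x_t, u_t)` and enters the cost linearly,
so only its mean matters (`integral_stageCost_of_indepFun`). What remains is a discounted
linear-quadratic problem with value function `V(x) = x'Mx + 2p'x + r`. Completing the square
(`IsRiccatiSolution.bellman`, `integral_jointCost`) gives, whenever the state and control have
second moments, `E[cost_t] = β^t E V(x_t) - β^(t+1) E V(x_{t+1}) + β^t E[(u_t - F x_t - h)' S (u_t -
F x_t - h)]`. The sum telescopes. For any strategy of finite cost, coercivity of the stage cost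
bounds `β^T E V(x_T)` above by a null sequence, so its cost is at least `E V(x_0)`
(`le_believedCost`). For the affine feedback the squares vanish and `V` is bounded below, so its
cost is at most `E V(x_0)` (`believedCost_affineStrategy_le`).

Constants. Value iteration from `0` increases and is bounded by the cost of a stabilizing feedback,
so it converges to a Riccati solution. Two solutions are compared by using the feedback of one as a
trial control for the other. The Lyapunov inequality makes the powers of `√β (A + BF)` bounded, so
those of `Γ = β (A + BF)'` decay like `√β ^ n`. This gives the series for `G` and the inverse of `1
- Γ`. -/

namespace LQ

/-! ### Quadratic and bilinear forms of real matrices. -/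

section Forms

variable {m n : ℕ}

theorem dotProduct_mulVec_transpose (X : Matrix (Fin m) (Fin n) ℝ) (a : Vec n) (b : Vec m) :
    a ⬝ᵥ (Xᵀ *ᵥ b) = (X *ᵥ a) ⬝ᵥ b := by
  rw [Matrix.dotProduct_mulVec, Matrix.vecMul_transpose]

theorem dotProduct_mulVec_comm {M : Matrix (Fin n) (Fin n) ℝ} (hM : Mᵀ = M) (a b : Vec n) :
    a ⬝ᵥ (M *ᵥ b) = b ⬝ᵥ (M *ᵥ a) := by
  conv_lhs => rw [← hM]
  rw [dotProduct_mulVec_transpose, dotProduct_comm]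

theorem _root_.Matrix.PosSemidef.transpose_eq {M : Matrix (Fin n) (Fin n) ℝ} (hM : M.PosSemidef) :
    Mᵀ = M := by
  simpa [Matrix.IsHermitian, Matrix.conjTranspose_eq_transpose_of_trivial] using hM.1

theorem _root_.Matrix.PosSemidef.form_nonneg {M : Matrix (Fin n) (Fin n) ℝ} (hM : M.PosSemidef)
    (x : Vec n) : 0 ≤ x ⬝ᵥ (M *ᵥ x) := by
  simpa using hM.dotProduct_mulVec_nonneg x

theorem posSemidef_of_form {M : Matrix (Fin n) (Fin n) ℝ} (hM : Mᵀ = M)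
    (h : ∀ x : Vec n, 0 ≤ x ⬝ᵥ (M *ᵥ x)) : M.PosSemidef :=
  .of_dotProduct_mulVec_nonneg
    (by simpa [Matrix.IsHermitian, Matrix.conjTranspose_eq_transpose_of_trivial] using hM)
    (by simpa using h)

theorem form_add {M : Matrix (Fin n) (Fin n) ℝ} (hM : Mᵀ = M) (a b : Vec n) :
    (a + b) ⬝ᵥ (M *ᵥ (a + b)) = a ⬝ᵥ (M *ᵥ a) + 2 * (a ⬝ᵥ (M *ᵥ b)) + b ⬝ᵥ (M *ᵥ b) := by
  simp only [Matrix.mulVec_add, add_dotProduct, dotProduct_add, dotProduct_mulVec_comm hM b a]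
  ring

theorem form_sub {M : Matrix (Fin n) (Fin n) ℝ} (hM : Mᵀ = M) (a b : Vec n) :
    (a - b) ⬝ᵥ (M *ᵥ (a - b)) = a ⬝ᵥ (M *ᵥ a) - 2 * (a ⬝ᵥ (M *ᵥ b)) + b ⬝ᵥ (M *ᵥ b) := by
  simp only [Matrix.mulVec_sub, sub_dotProduct, dotProduct_sub, dotProduct_mulVec_comm hM b a]
  ring

/-- Polarization: it carries identities and limits of quadratic forms over to the matrix entries. -/
theorem apply_eq_form {M : Matrix (Fin n) (Fin n) ℝ} (hM : Mᵀ = M) (i j : Fin n) :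
    M i j = ((Pi.single i 1 + Pi.single j 1 : Vec n) ⬝ᵥ (M *ᵥ (Pi.single i 1 + Pi.single j 1)) -
      (Pi.single i 1 : Vec n) ⬝ᵥ (M *ᵥ Pi.single i 1) -
      (Pi.single j 1 : Vec n) ⬝ᵥ (M *ᵥ Pi.single j 1)) / 2 := by
  rw [form_add hM]
  simp only [Matrix.mulVec_single_one, single_one_dotProduct, Matrix.col_apply]
  ring

theorem eq_of_form_eq {M N : Matrix (Fin n) (Fin n) ℝ} (hM : Mᵀ = M) (hN : Nᵀ = N)
    (h : ∀ x : Vec n, x ⬝ᵥ (M *ᵥ x) = x ⬝ᵥ (N *ᵥ x)) : M = N := by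
  ext i j
  rw [apply_eq_form hM, apply_eq_form hN, h, h, h]

/-- A positive definite form dominates a multiple of the squared norm. -/
theorem _root_.Matrix.PosDef.exists_le_form {M : Matrix (Fin n) (Fin n) ℝ} (hM : M.PosDef) :
    ∃ a : ℝ, 0 < a ∧ ∀ x : Vec n, a * ‖x‖ ^ 2 ≤ x ⬝ᵥ (M *ᵥ x) := by
  have hcont : Continuous fun x : Vec n => x ⬝ᵥ (M *ᵥ x) := by fun_prop
  rcases (Metric.sphere (0 : Vec n) 1).eq_empty_or_nonempty with he | hne
  · refine ⟨1, one_pos, fun x => ?_⟩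
    have hx : x = 0 := by
      by_contra hx
      have : ‖x‖⁻¹ • x ∈ Metric.sphere (0 : Vec n) 1 := by
        simp [norm_smul, inv_mul_cancel₀ (norm_ne_zero_iff.mpr hx)]
      simp [he] at this
    simp [hx]
  · obtain ⟨v, hv, hmin⟩ := (isCompact_sphere (0 : Vec n) 1).exists_isMinOn hne hcont.continuousOn
    have hv0 : v ≠ 0 := by
      rintro rfl
      simp at hv
    refine ⟨v ⬝ᵥ (M *ᵥ v), by simpa using hM.dotProduct_mulVec_pos hv0, fun x => ?_⟩
    by_cases hx : x = 0
    · simp [hx]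
    have hn : ‖x‖ ≠ 0 := norm_ne_zero_iff.mpr hx
    have h1 : ‖x‖⁻¹ • x ∈ Metric.sphere (0 : Vec n) 1 := by
      simp [norm_smul, inv_mul_cancel₀ hn]
    have h2 : v ⬝ᵥ (M *ᵥ v) ≤ (‖x‖⁻¹ • x) ⬝ᵥ (M *ᵥ (‖x‖⁻¹ • x)) := hmin h1
    simp only [Matrix.mulVec_smul, smul_dotProduct, dotProduct_smul, smul_eq_mul] at h2
    calc v ⬝ᵥ (M *ᵥ v) * ‖x‖ ^ 2 ≤ (‖x‖⁻¹ * (‖x‖⁻¹ * x ⬝ᵥ (M *ᵥ x))) * ‖x‖ ^ 2 := by gcongr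
      _ = x ⬝ᵥ (M *ᵥ x) := by field_simp

/-- A bilinear form is bounded. -/
theorem exists_abs_dotProduct_mulVec_le (N : Matrix (Fin m) (Fin n) ℝ) :
    ∃ C : ℝ, 0 ≤ C ∧ ∀ (x : Vec m) (y : Vec n), |x ⬝ᵥ (N *ᵥ y)| ≤ C * ‖x‖ * ‖y‖ := by
  refine ⟨∑ i, ∑ j, |N i j|, by positivity, fun x y => ?_⟩
  simp only [dotProduct, Matrix.mulVec, Finset.mul_sum, Finset.sum_mul]
  refine (Finset.abs_sum_le_sum_abs _ _).trans (Finset.sum_le_sum fun i _ => ?_)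
  refine (Finset.abs_sum_le_sum_abs _ _).trans (Finset.sum_le_sum fun j _ => ?_)
  rw [abs_mul, abs_mul]
  have h1 : |x i| ≤ ‖x‖ := norm_le_pi_norm x i
  have h2 : |y j| ≤ ‖y‖ := norm_le_pi_norm y j
  calc |x i| * (|N i j| * |y j|) ≤ ‖x‖ * (|N i j| * ‖y‖) := by gcongr
    _ = _ := by ring

end Forms

/-! ### The Riccati map and value iteration. -/

namespace Game

variable {nx nu ny : ℕ} (g : Game nx nu ny)

/-- The right-hand side of the Riccati equation. -/
noncomputable def riccatiMap (M : Matrix (Fin nx) (Fin nx) ℝ) : Matrix (Fin nx) (Fin nx) ℝ :=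
  g.Q + g.β • (g.Aᵀ * (M - g.β • (M * g.B * (g.S M)⁻¹ * g.Bᵀ * M)) * g.A)

/-- The closed loop matrix. -/
noncomputable def closedLoop (M : Matrix (Fin nx) (Fin nx) ℝ) : Matrix (Fin nx) (Fin nx) ℝ :=
  g.A + g.B * g.F M

variable {g}

theorem posDef_S (hR : g.R.PosDef) (hβ₀ : 0 ≤ g.β) {M : Matrix (Fin nx) (Fin nx) ℝ}
    (hM : M.PosSemidef) : (g.S M).PosDef := by
  have h := hM.conjTranspose_mul_mul_same g.B
  rw [Matrix.conjTranspose_eq_transpose_of_trivial] at h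
  exact hR.add_posSemidef (h.smul hβ₀)

theorem S_mulVec_S_inv (hR : g.R.PosDef) (hβ₀ : 0 ≤ g.β) {M : Matrix (Fin nx) (Fin nx) ℝ}
    (hM : M.PosSemidef) (v : Vec nu) : g.S M *ᵥ ((g.S M)⁻¹ *ᵥ v) = v := by
  have hS := (posDef_S hR hβ₀ hM).isUnit
  rw [Matrix.mulVec_mulVec, Matrix.mul_nonsing_inv _ ((Matrix.isUnit_iff_isUnit_det _).1 hS),
    Matrix.one_mulVec]

theorem S_mulVec_F (hR : g.R.PosDef) (hβ₀ : 0 ≤ g.β) {M : Matrix (Fin nx) (Fin nx) ℝ}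
    (hM : M.PosSemidef) (x : Vec nx) :
    g.S M *ᵥ (g.F M *ᵥ x) = -(g.β • (g.Bᵀ *ᵥ (M *ᵥ (g.A *ᵥ x)))) := by
  simp only [F, Matrix.neg_mulVec, Matrix.smul_mulVec, Matrix.mulVec_neg, Matrix.mulVec_smul,
    ← Matrix.mulVec_mulVec, S_mulVec_S_inv hR hβ₀ hM]

theorem form_S (M : Matrix (Fin nx) (Fin nx) ℝ) (u v : Vec nu) :
    u ⬝ᵥ (g.S M *ᵥ v) = u ⬝ᵥ (g.R *ᵥ v) + g.β * ((g.B *ᵥ u) ⬝ᵥ (M *ᵥ (g.B *ᵥ v))) := by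
  simp only [S, Matrix.add_mulVec, Matrix.smul_mulVec, ← Matrix.mulVec_mulVec, dotProduct_add,
    dotProduct_smul, dotProduct_mulVec_transpose, smul_eq_mul]

/-- Completing the square in the one-step problem. -/
theorem one_step_form (hR : g.R.PosDef) (hβ₀ : 0 ≤ g.β) {M : Matrix (Fin nx) (Fin nx) ℝ}
    (hM : M.PosSemidef) (x : Vec nx) (u : Vec nu) :
    x ⬝ᵥ (g.Q *ᵥ x) + u ⬝ᵥ (g.R *ᵥ u) +
      g.β * ((g.A *ᵥ x + g.B *ᵥ u) ⬝ᵥ (M *ᵥ (g.A *ᵥ x + g.B *ᵥ u))) =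
    x ⬝ᵥ (g.riccatiMap M *ᵥ x) + (u - g.F M *ᵥ x) ⬝ᵥ (g.S M *ᵥ (u - g.F M *ᵥ x)) := by
  have hMt := hM.transpose_eq
  have hSF := S_mulVec_F hR hβ₀ hM x
  have h1 : x ⬝ᵥ (g.riccatiMap M *ᵥ x) = x ⬝ᵥ (g.Q *ᵥ x) +
      g.β * ((g.A *ᵥ x) ⬝ᵥ (M *ᵥ (g.A *ᵥ x))) -
      (g.F M *ᵥ x) ⬝ᵥ (g.S M *ᵥ (g.F M *ᵥ x)) := by
    rw [hSF]
    simp only [riccatiMap, F, Matrix.add_mulVec, Matrix.sub_mulVec, Matrix.smul_mulVec,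
      ← Matrix.mulVec_mulVec, dotProduct_add, dotProduct_sub,
      dotProduct_smul, dotProduct_mulVec_transpose, smul_eq_mul, Matrix.neg_mulVec,
      dotProduct_neg, neg_dotProduct, smul_dotProduct]
    rw [dotProduct_mulVec_comm hMt (g.A *ᵥ x) (g.B *ᵥ _)]
    ring
  rw [h1, form_sub (posDef_S hR hβ₀ hM).posSemidef.transpose_eq, form_add hMt, hSF, form_S]
  simp only [dotProduct_neg, dotProduct_smul, dotProduct_mulVec_transpose, smul_eq_mul]
  rw [dotProduct_mulVec_comm hMt (g.A *ᵥ x) (g.B *ᵥ u)]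
  ring

/-- With `riccatiMap_form_eq`, this makes the Riccati map a minimum over controls, attained at `u =
F x`. Monotonicity, boundedness and uniqueness all come from inserting a suboptimal control here. -/
theorem riccatiMap_form_le (hR : g.R.PosDef) (hβ₀ : 0 ≤ g.β) {M : Matrix (Fin nx) (Fin nx) ℝ}
    (hM : M.PosSemidef) (x : Vec nx) (u : Vec nu) :
    x ⬝ᵥ (g.riccatiMap M *ᵥ x) ≤ x ⬝ᵥ (g.Q *ᵥ x) + u ⬝ᵥ (g.R *ᵥ u) +
      g.β * ((g.A *ᵥ x + g.B *ᵥ u) ⬝ᵥ (M *ᵥ (g.A *ᵥ x + g.B *ᵥ u))) := by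
  rw [one_step_form hR hβ₀ hM]
  linarith [(posDef_S hR hβ₀ hM).posSemidef.form_nonneg (u - g.F M *ᵥ x)]

theorem riccatiMap_form_eq (hR : g.R.PosDef) (hβ₀ : 0 ≤ g.β) {M : Matrix (Fin nx) (Fin nx) ℝ}
    (hM : M.PosSemidef) (x : Vec nx) :
    x ⬝ᵥ (g.riccatiMap M *ᵥ x) = x ⬝ᵥ (g.Q *ᵥ x) + (g.F M *ᵥ x) ⬝ᵥ (g.R *ᵥ (g.F M *ᵥ x)) +
      g.β * ((g.closedLoop M *ᵥ x) ⬝ᵥ (M *ᵥ (g.closedLoop M *ᵥ x))) := by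
  have h := one_step_form hR hβ₀ hM x (g.F M *ᵥ x)
  rw [sub_self, zero_dotProduct, add_zero] at h
  rw [← h, closedLoop, Matrix.add_mulVec, ← Matrix.mulVec_mulVec x g.B]

theorem riccatiMap_posSemidef (hQ : g.Q.PosDef) (hR : g.R.PosDef) (hβ₀ : 0 ≤ g.β)
    {M : Matrix (Fin nx) (Fin nx) ℝ} (hM : M.PosSemidef) : (g.riccatiMap M).PosSemidef := by
  refine posSemidef_of_form ?_ fun x => ?_
  · have h1 := hM.transpose_eq
    have h2 := (posDef_S hR hβ₀ hM).posSemidef.transpose_eq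
    have h3 := hQ.posSemidef.transpose_eq
    simp only [riccatiMap, Matrix.transpose_add, Matrix.transpose_smul, Matrix.transpose_mul,
      Matrix.transpose_sub, Matrix.transpose_transpose, h1, h3, Matrix.transpose_nonsing_inv, h2,
      Matrix.mul_assoc]
  · rw [riccatiMap_form_eq hR hβ₀ hM]
    have h1 := hQ.posSemidef.form_nonneg x
    have h2 := hR.posSemidef.form_nonneg (g.F M *ᵥ x)
    have h3 := mul_nonneg hβ₀ (hM.form_nonneg (g.closedLoop M *ᵥ x))
    linarith

/-- Value iteration for the Riccati equation. -/
noncomputable def riccatiIter (g : Game nx nu ny) : ℕ → Matrix (Fin nx) (Fin nx) ℝ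
  | 0 => 0
  | k + 1 => g.riccatiMap (riccatiIter g k)

theorem riccatiIter_posSemidef (hQ : g.Q.PosDef) (hR : g.R.PosDef) (hβ₀ : 0 ≤ g.β) (k : ℕ) :
    (g.riccatiIter k).PosSemidef := by
  induction k with
  | zero => exact .zero
  | succ k ih => exact riccatiMap_posSemidef hQ hR hβ₀ ih

/-- The minimizing control for `N` is a trial control for `M`, and the one-step cost is monotone in
the terminal form because `β ≥ 0`. -/
theorem riccatiMap_form_mono (hR : g.R.PosDef) (hβ₀ : 0 ≤ g.β)
    {M N : Matrix (Fin nx) (Fin nx) ℝ} (hM : M.PosSemidef) (hN : N.PosSemidef)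
    (h : ∀ x : Vec nx, x ⬝ᵥ (M *ᵥ x) ≤ x ⬝ᵥ (N *ᵥ x)) (x : Vec nx) :
    x ⬝ᵥ (g.riccatiMap M *ᵥ x) ≤ x ⬝ᵥ (g.riccatiMap N *ᵥ x) := by
  refine (riccatiMap_form_le hR hβ₀ hM x (g.F N *ᵥ x)).trans ?_
  rw [riccatiMap_form_eq hR hβ₀ hN, closedLoop, Matrix.add_mulVec, ← Matrix.mulVec_mulVec]
  gcongr
  exact h _

theorem riccatiIter_form_mono (hQ : g.Q.PosDef) (hR : g.R.PosDef) (hβ₀ : 0 ≤ g.β) (x : Vec nx) :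
    Monotone fun k => x ⬝ᵥ (g.riccatiIter k *ᵥ x) := by
  have h : ∀ k, ∀ x : Vec nx,
      x ⬝ᵥ (g.riccatiIter k *ᵥ x) ≤ x ⬝ᵥ (g.riccatiIter (k + 1) *ᵥ x) := by
    intro k
    induction k with
    | zero =>
      intro x
      simpa [riccatiIter] using (riccatiIter_posSemidef hQ hR hβ₀ 1).form_nonneg x
    | succ k ih =>
      exact riccatiMap_form_mono hR hβ₀ (riccatiIter_posSemidef hQ hR hβ₀ k)
        (riccatiIter_posSemidef hQ hR hβ₀ (k + 1)) ih
  exact monotone_nat_of_le_succ fun k => h k x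

end Game

/-- The powers of a stable matrix are bounded. -/
theorem IsStable.exists_pow_mulVec_le {n : ℕ} {A : Matrix (Fin n) (Fin n) ℝ} (hA : IsStable A) :
    ∃ C : ℝ, 0 ≤ C ∧ ∀ (k : ℕ) (x : Vec n), ‖A ^ k *ᵥ x‖ ≤ C * ‖x‖ := by
  let _ : NormedRing (Matrix (Fin n) (Fin n) ℂ) := Matrix.linftyOpNormedRing
  let _ : NormedAlgebra ℂ (Matrix (Fin n) (Fin n) ℂ) := Matrix.linftyOpNormedAlgebra
  have _ : CompleteSpace (Matrix (Fin n) (Fin n) ℂ) := FiniteDimensional.complete ℂ _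
  -- For `n = 0` the matrix algebra is trivial and has empty spectrum; the strict bound on the
  -- spectral radius is taken from a nonempty one.
  rcases isEmpty_or_nonempty (Fin n) with hn | hn
  · exact ⟨0, le_rfl, fun k x => by simp [Subsingleton.elim x 0]⟩
  set Z := A.map (algebraMap ℝ ℂ) with hZ
  have hr : spectralRadius ℂ Z < (1 : NNReal) :=
    spectrum.spectralRadius_lt_of_forall_lt Z fun c hc => by
      have := hA c hc
      exact_mod_cast this
  -- Gelfand's formula: `‖Z ^ k‖ ^ (1 / k)` tends to a number below `1`, whereas `‖Z ^ k‖ > 1` would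
  -- keep this root at least `1`.
  have hev : ∀ᶠ k : ℕ in atTop, ‖Z ^ k‖ ≤ 1 := by
    have ht := spectrum.pow_nnnorm_pow_one_div_tendsto_nhds_spectralRadius Z
    filter_upwards [ht.eventually (gt_mem_nhds hr), eventually_gt_atTop 0] with k hk hk0
    by_contra! hlt
    have h1 : (1 : ℝ≥0∞) ≤ (‖Z ^ k‖₊ : ℝ≥0∞) := by
      exact_mod_cast hlt.le
    have h2 : (1 : ℝ≥0∞) ≤ (‖Z ^ k‖₊ : ℝ≥0∞) ^ (1 / k : ℝ) :=
      ENNReal.one_le_rpow h1 (by positivity)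
    exact absurd hk (not_lt.mpr (by simpa using h2))
  obtain ⟨N, hN⟩ := eventually_atTop.1 hev
  have hbd : ∃ C : ℝ, 0 ≤ C ∧ ∀ k, ‖Z ^ k‖ ≤ C := by
    refine ⟨1 + ∑ k ∈ Finset.range N, ‖Z ^ k‖, by positivity, fun k => ?_⟩
    rcases lt_or_ge k N with hk | hk
    · have := Finset.single_le_sum (f := fun k => ‖Z ^ k‖) (fun i _ => norm_nonneg _)
        (Finset.mem_range.2 hk)
      linarith
    · have h1 := hN k hk
      have h2 : 0 ≤ ∑ k ∈ Finset.range N, ‖Z ^ k‖ := by positivity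
      linarith
  obtain ⟨C, hC0, hC⟩ := hbd
  refine ⟨C, hC0, fun k x => ?_⟩
  have h1 : (algebraMap ℝ ℂ) ∘ (A ^ k *ᵥ x) = Z ^ k *ᵥ ((algebraMap ℝ ℂ) ∘ x) := by
    have h2 : Z ^ k = (A ^ k).map (algebraMap ℝ ℂ) := by
      rw [hZ]
      exact (map_pow (algebraMap ℝ ℂ).mapMatrix A k).symm
    rw [h2]
    funext i
    exact RingHom.map_mulVec (algebraMap ℝ ℂ) (A ^ k) x i
  have hnorm : ∀ y : Vec n, ‖(algebraMap ℝ ℂ) ∘ y‖ = ‖y‖ := fun y => by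
    simp [Pi.norm_def]
  rw [← hnorm, h1, ← hnorm x]
  exact (Matrix.linfty_opNorm_mulVec _ _).trans (by gcongr; exact hC k)

/-! ### Existence and uniqueness of the Riccati solution. -/

namespace Game

variable {nx nu ny : ℕ} {g : Game nx nu ny}

theorem IsRiccatiSolution.riccatiMap_eq {M : Matrix (Fin nx) (Fin nx) ℝ}
    (hM : g.IsRiccatiSolution M) : g.riccatiMap M = M := hM.2.symm

/-- The iterates are optimal finite-horizon costs, hence dominated by the cost of a stabilizing
feedback. Bounded powers of its closed loop suffice, since discounting makes the sum of stage costs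
converge. -/
theorem exists_riccatiIter_form_le (hQ : g.Q.PosDef) (hR : g.R.PosDef) (hβ₀ : 0 ≤ g.β)
    (hβ₁ : g.β < 1) (hAB : IsStabilizable g.A g.B) :
    ∃ C : ℝ, ∀ (k : ℕ) (x : Vec nx), x ⬝ᵥ (g.riccatiIter k *ᵥ x) ≤ C * ‖x‖ ^ 2 := by
  obtain ⟨F₀, hF₀⟩ := hAB
  obtain ⟨C, hC0, hC⟩ := hF₀.exists_pow_mulVec_le
  obtain ⟨D, hD0, hD⟩ := exists_abs_dotProduct_mulVec_le (g.Q + F₀ᵀ * g.R * F₀)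
  have h1β : 0 < 1 - g.β := by linarith
  have hW : ∀ (j : ℕ) (x : Vec nx),
      ((g.A + g.B * F₀) ^ j *ᵥ x) ⬝ᵥ ((g.Q + F₀ᵀ * g.R * F₀) *ᵥ ((g.A + g.B * F₀) ^ j *ᵥ x)) ≤
        D * C ^ 2 * ‖x‖ ^ 2 := fun j x => by
    refine (le_abs_self _).trans ((hD _ _).trans ?_)
    calc D * ‖(g.A + g.B * F₀) ^ j *ᵥ x‖ * ‖(g.A + g.B * F₀) ^ j *ᵥ x‖
        ≤ D * (C * ‖x‖) * (C * ‖x‖) := by gcongr <;> exact hC j x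
      _ = _ := by ring
  -- The bound is stated along the whole orbit of `x`, with one constant for all `j`: a bound by the
  -- current norm would lose a factor at each step of the induction. The constant solves `κ = D C² +
  -- β κ`.
  have key : ∀ (k j : ℕ) (x : Vec nx), ((g.A + g.B * F₀) ^ j *ᵥ x) ⬝ᵥ
      (g.riccatiIter k *ᵥ ((g.A + g.B * F₀) ^ j *ᵥ x)) ≤
        D * C ^ 2 / (1 - g.β) * ‖x‖ ^ 2 := by
    intro k
    induction k with
    | zero =>
      intro j x
      simp only [riccatiIter, Matrix.zero_mulVec, dotProduct_zero]
      positivity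
    | succ k ih =>
      intro j x
      have h1 := riccatiMap_form_le hR hβ₀ (riccatiIter_posSemidef hQ hR hβ₀ k)
        ((g.A + g.B * F₀) ^ j *ᵥ x) (F₀ *ᵥ ((g.A + g.B * F₀) ^ j *ᵥ x))
      have h2 := ih (j + 1) x
      have h3 := hW j x
      rw [pow_succ', ← Matrix.mulVec_mulVec] at h2
      set y := (g.A + g.B * F₀) ^ j *ᵥ x
      simp only [Matrix.add_mulVec, ← Matrix.mulVec_mulVec, dotProduct_add,
        dotProduct_mulVec_transpose] at h2 h3
      rw [riccatiIter]
      refine h1.trans ?_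
      have h4 := mul_le_mul_of_nonneg_left h2 hβ₀
      have h5 : D * C ^ 2 / (1 - g.β) * ‖x‖ ^ 2 =
          D * C ^ 2 * ‖x‖ ^ 2 + g.β * (D * C ^ 2 / (1 - g.β) * ‖x‖ ^ 2) := by
        field_simp
        ring
      rw [h5]
      linarith
  exact ⟨_, fun k x => by simpa using key k 0 x⟩

/-- Continuity holds where `det S ≠ 0`, in particular at positive semidefinite `M`; the inverse is
the adjugate divided by the determinant. -/
theorem continuousAt_riccatiMap (hR : g.R.PosDef) (hβ₀ : 0 ≤ g.β)
    {M : Matrix (Fin nx) (Fin nx) ℝ} (hM : M.PosSemidef) : ContinuousAt g.riccatiMap M := by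
  have hdet : (g.S M).det ≠ 0 := (posDef_S hR hβ₀ hM).det_pos.ne'
  have hS : Continuous g.S := by unfold S; fun_prop
  have hinv : ContinuousAt (fun N => (g.S N)⁻¹) M := by
    simp only [Matrix.inv_def, Ring.inverse_eq_inv']
    exact ((hS.matrix_det.continuousAt).inv₀ hdet).smul hS.matrix_adjugate.continuousAt
  have hmul : ∀ {a b c : ℕ} {X : Matrix (Fin nx) (Fin nx) ℝ → Matrix (Fin a) (Fin b) ℝ}
      {Y : Matrix (Fin nx) (Fin nx) ℝ → Matrix (Fin b) (Fin c) ℝ},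
      ContinuousAt X M → ContinuousAt Y M → ContinuousAt (fun N => X N * Y N) M :=
    fun {a b c X Y} hX hY => ContinuousAt.comp (f := fun N => (X N, Y N))
      (g := fun q : Matrix (Fin a) (Fin b) ℝ × Matrix (Fin b) (Fin c) ℝ => q.1 * q.2)
      (continuous_fst.matrix_mul continuous_snd).continuousAt (hX.prodMk hY)
  unfold riccatiMap
  exact continuousAt_const.add ((hmul (hmul continuousAt_const (continuousAt_id.sub
    ((hmul (hmul (hmul (hmul continuousAt_id continuousAt_const) hinv) continuousAt_const)
      continuousAt_id).const_smul g.β))) continuousAt_const).const_smul g.β)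

/-- The monotone bounded forms converge pointwise, polarization turns this into convergence of
matrices, and continuity makes the limit a fixed point. -/
theorem exists_isRiccatiSolution (hQ : g.Q.PosDef) (hR : g.R.PosDef) (hβ₀ : 0 ≤ g.β)
    (hβ₁ : g.β < 1) (hAB : IsStabilizable g.A g.B) : ∃ M, g.IsRiccatiSolution M := by
  obtain ⟨C, hC⟩ := exists_riccatiIter_form_le hQ hR hβ₀ hβ₁ hAB
  have hlim : ∀ x : Vec nx, ∃ l, Tendsto (fun k => x ⬝ᵥ (g.riccatiIter k *ᵥ x)) atTop (nhds l) :=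
    fun x => ⟨_, tendsto_atTop_ciSup (riccatiIter_form_mono hQ hR hβ₀ x)
      ⟨C * ‖x‖ ^ 2, by rintro _ ⟨k, rfl⟩; exact hC k x⟩⟩
  choose l hl using hlim
  have hsym := fun k => (riccatiIter_posSemidef hQ hR hβ₀ k).transpose_eq
  set M : Matrix (Fin nx) (Fin nx) ℝ := Matrix.of fun i j =>
    (l (Pi.single i 1 + Pi.single j 1) - l (Pi.single i 1) - l (Pi.single j 1)) / 2
  have hM : Tendsto g.riccatiIter atTop (nhds M) := by
    refine tendsto_pi_nhds.2 fun i => tendsto_pi_nhds.2 fun j => ?_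
    have h := (((hl (Pi.single i 1 + Pi.single j 1)).sub (hl (Pi.single i 1))).sub
      (hl (Pi.single j 1))).div_const 2
    exact h.congr fun k => (apply_eq_form (hsym k) i j).symm
  have hpsd : M.PosSemidef := by
    refine posSemidef_of_form ?_ fun x => ?_
    · have h1 : Tendsto (fun k => (g.riccatiIter k)ᵀ) atTop (nhds Mᵀ) :=
        ((continuous_id.matrix_transpose).tendsto M).comp hM
      simp only [hsym] at h1
      exact tendsto_nhds_unique h1 hM
    · have h1 : Continuous fun N : Matrix (Fin nx) (Fin nx) ℝ => x ⬝ᵥ (N *ᵥ x) := by fun_prop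
      exact ge_of_tendsto' ((h1.tendsto M).comp hM)
        fun k => (riccatiIter_posSemidef hQ hR hβ₀ k).form_nonneg x
  refine ⟨M, hpsd, ?_⟩
  have h1 : Tendsto (fun k => g.riccatiIter (k + 1)) atTop (nhds (g.riccatiMap M)) :=
    (continuousAt_riccatiMap hR hβ₀ hpsd).tendsto.comp hM
  exact tendsto_nhds_unique (hM.comp (tendsto_add_atTop_nat 1)) h1

variable {M : Matrix (Fin nx) (Fin nx) ℝ}

/-- The Lyapunov inequality along the closed loop. -/
theorem IsRiccatiSolution.form_add_le (hM : g.IsRiccatiSolution M) (hR : g.R.PosDef)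
    (hβ₀ : 0 ≤ g.β) (x : Vec nx) :
    x ⬝ᵥ (g.Q *ᵥ x) + g.β * ((g.closedLoop M *ᵥ x) ⬝ᵥ (M *ᵥ (g.closedLoop M *ᵥ x))) ≤
      x ⬝ᵥ (M *ᵥ x) := by
  have h := riccatiMap_form_eq hR hβ₀ hM.1 x
  rw [hM.riccatiMap_eq] at h
  linarith [hR.posSemidef.form_nonneg (g.F M *ᵥ x)]

/-- The Lyapunov inequality iterated along the closed-loop orbit of `x`. -/
theorem IsRiccatiSolution.sum_form_add_le (hM : g.IsRiccatiSolution M) (hR : g.R.PosDef)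
    (hβ₀ : 0 ≤ g.β) (x : Vec nx) (N : ℕ) :
    ∑ n ∈ Finset.range N, g.β ^ n *
        ((g.closedLoop M ^ n *ᵥ x) ⬝ᵥ (g.Q *ᵥ (g.closedLoop M ^ n *ᵥ x))) +
      g.β ^ N * ((g.closedLoop M ^ N *ᵥ x) ⬝ᵥ (M *ᵥ (g.closedLoop M ^ N *ᵥ x))) ≤
      x ⬝ᵥ (M *ᵥ x) := by
  induction N with
  | zero => simp
  | succ N ih =>
    refine le_trans ?_ ih
    rw [Finset.sum_range_succ, add_assoc]
    gcongr
    have h := mul_le_mul_of_nonneg_left (hM.form_add_le hR hβ₀ (g.closedLoop M ^ N *ᵥ x))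
      (pow_nonneg hβ₀ N)
    rw [Matrix.mulVec_mulVec _ (g.closedLoop M), ← pow_succ'] at h
    refine le_trans (le_of_eq ?_) h
    ring

theorem IsRiccatiSolution.exists_le_form (hM : g.IsRiccatiSolution M) (hQ : g.Q.PosDef)
    (hR : g.R.PosDef) (hβ₀ : 0 ≤ g.β) :
    ∃ a : ℝ, 0 < a ∧ ∀ x : Vec nx, a * ‖x‖ ^ 2 ≤ x ⬝ᵥ (M *ᵥ x) := by
  obtain ⟨a, ha, h⟩ := hQ.exists_le_form
  refine ⟨a, ha, fun x => (h x).trans (le_trans ?_ (hM.form_add_le hR hβ₀ x))⟩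
  have := mul_nonneg hβ₀ (hM.1.form_nonneg (g.closedLoop M *ᵥ x))
  linarith

/-- The discounted `Q`-costs along the orbit have sum at most `x'Mx`, so their terms vanish, and `Q`
is coercive. -/
theorem IsRiccatiSolution.tendsto_pow_mulVec (hM : g.IsRiccatiSolution M) (hQ : g.Q.PosDef)
    (hR : g.R.PosDef) (hβ₀ : 0 ≤ g.β) (x : Vec nx) :
    Tendsto (fun n => g.β ^ n * ‖g.closedLoop M ^ n *ᵥ x‖ ^ 2) atTop (nhds 0) := by
  obtain ⟨a, ha, h⟩ := hQ.exists_le_form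
  have hs : Summable fun n => g.β ^ n *
      ((g.closedLoop M ^ n *ᵥ x) ⬝ᵥ (g.Q *ᵥ (g.closedLoop M ^ n *ᵥ x))) := by
    refine summable_of_sum_range_le (c := x ⬝ᵥ (M *ᵥ x)) (fun n => mul_nonneg (pow_nonneg hβ₀ n)
      (hQ.posSemidef.form_nonneg _)) fun N => ?_
    have h1 := hM.sum_form_add_le hR hβ₀ x N
    have h2 := mul_nonneg (pow_nonneg hβ₀ N) (hM.1.form_nonneg (g.closedLoop M ^ N *ᵥ x))
    linarith
  have h0 : Tendsto (fun n => a⁻¹ * (g.β ^ n *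
      ((g.closedLoop M ^ n *ᵥ x) ⬝ᵥ (g.Q *ᵥ (g.closedLoop M ^ n *ᵥ x))))) atTop (nhds 0) := by
    simpa using hs.tendsto_atTop_zero.const_mul a⁻¹
  refine squeeze_zero (fun n => by positivity) (fun n => ?_) h0
  rw [le_inv_mul_iff₀ ha]
  calc a * (g.β ^ n * ‖g.closedLoop M ^ n *ᵥ x‖ ^ 2)
      = g.β ^ n * (a * ‖g.closedLoop M ^ n *ᵥ x‖ ^ 2) := by ring
    _ ≤ _ := by gcongr; exact h _

/-- The feedback of `N` is exact for `N` and suboptimal for `M`. So `M - N` at `y` is at most `β`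
times `M - N` at the next closed-loop state of `N`; iterating leaves a remainder of order `β ^ n
‖x_n‖²`, which tends to `0`. Uniqueness follows by symmetry. -/
theorem IsRiccatiSolution.form_le (hQ : g.Q.PosDef) (hR : g.R.PosDef) (hβ₀ : 0 ≤ g.β)
    {N : Matrix (Fin nx) (Fin nx) ℝ} (hM : g.IsRiccatiSolution M) (hN : g.IsRiccatiSolution N)
    (x : Vec nx) : x ⬝ᵥ (M *ᵥ x) ≤ x ⬝ᵥ (N *ᵥ x) := by
  have step : ∀ y : Vec nx, y ⬝ᵥ (M *ᵥ y) - y ⬝ᵥ (N *ᵥ y) ≤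
      g.β * ((g.closedLoop N *ᵥ y) ⬝ᵥ (M *ᵥ (g.closedLoop N *ᵥ y)) -
        (g.closedLoop N *ᵥ y) ⬝ᵥ (N *ᵥ (g.closedLoop N *ᵥ y))) := fun y => by
    have h1 := riccatiMap_form_le hR hβ₀ hM.1 y (g.F N *ᵥ y)
    have h2 := riccatiMap_form_eq hR hβ₀ hN.1 y
    rw [hM.riccatiMap_eq] at h1
    rw [hN.riccatiMap_eq] at h2
    rw [Matrix.mulVec_mulVec y g.B, ← Matrix.add_mulVec] at h1
    change y ⬝ᵥ (M *ᵥ y) ≤ _ + g.β * ((g.closedLoop N *ᵥ y) ⬝ᵥ _) at h1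
    change _ ≤ _ + g.β * (_ ⬝ᵥ (M *ᵥ (g.closedLoop N *ᵥ y))) at h1
    linarith
  have iter : ∀ n : ℕ, x ⬝ᵥ (M *ᵥ x) - x ⬝ᵥ (N *ᵥ x) ≤
      g.β ^ n * ((g.closedLoop N ^ n *ᵥ x) ⬝ᵥ (M *ᵥ (g.closedLoop N ^ n *ᵥ x)) -
        (g.closedLoop N ^ n *ᵥ x) ⬝ᵥ (N *ᵥ (g.closedLoop N ^ n *ᵥ x))) := fun n => by
    induction n with
    | zero => simp
    | succ n ih =>
      refine ih.trans ?_
      rw [pow_succ g.β, mul_assoc, pow_succ', ← Matrix.mulVec_mulVec]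
      gcongr
      exact step _
  obtain ⟨C, hC0, hC⟩ := exists_abs_dotProduct_mulVec_le M
  have h0 : Tendsto (fun n => C * (g.β ^ n * ‖g.closedLoop N ^ n *ᵥ x‖ ^ 2)) atTop (nhds 0) := by
    simpa using (hN.tendsto_pow_mulVec hQ hR hβ₀ x).const_mul C
  refine sub_nonpos.1 (ge_of_tendsto' h0 fun n => (iter n).trans ?_)
  have h1 := (le_abs_self _).trans (hC (g.closedLoop N ^ n *ᵥ x) (g.closedLoop N ^ n *ᵥ x))
  have h2 := hN.1.form_nonneg (g.closedLoop N ^ n *ᵥ x)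
  calc _ ≤ g.β ^ n * (C * ‖g.closedLoop N ^ n *ᵥ x‖ * ‖g.closedLoop N ^ n *ᵥ x‖) := by
        gcongr
        linarith
    _ = _ := by ring

theorem existsUnique_isRiccatiSolution (hQ : g.Q.PosDef) (hR : g.R.PosDef) (hβ₀ : 0 ≤ g.β)
    (hβ₁ : g.β < 1) (hAB : IsStabilizable g.A g.B) : ∃! M, g.IsRiccatiSolution M := by
  obtain ⟨M, hM⟩ := exists_isRiccatiSolution hQ hR hβ₀ hβ₁ hAB
  exact ⟨M, hM, fun N hN => eq_of_form_eq hN.1.transpose_eq hM.1.transpose_eq fun x =>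
    (IsRiccatiSolution.form_le hQ hR hβ₀ hN hM x).antisymm
      (IsRiccatiSolution.form_le hQ hR hβ₀ hM hN x)⟩

/-! ### The constants `G`, `H` and the linear part of the value function. -/

theorem Γ_pow (M : Matrix (Fin nx) (Fin nx) ℝ) (n : ℕ) :
    g.Γ M ^ n = g.β ^ n • (g.closedLoop M ^ n)ᵀ := by
  rw [Γ, smul_pow, Matrix.transpose_pow, closedLoop]

/-- `M` dominates `a ‖·‖²`, so the iterated Lyapunov inequality gives `β ^ n ‖x_n‖² ≤ c` along
closed-loop orbits. Then `β ^ n ‖x_n‖ ≤ √c √β ^ n`, a geometric bound on the entries of `Γ ^ n` that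
does not require the closed loop itself to be stable. -/
theorem IsRiccatiSolution.summable_Γ_pow (hM : g.IsRiccatiSolution M) (hQ : g.Q.PosDef)
    (hR : g.R.PosDef) (hβ₀ : 0 ≤ g.β) (hβ₁ : g.β < 1) : Summable (g.Γ M ^ ·) := by
  obtain ⟨a, ha, h⟩ := hM.exists_le_form hQ hR hβ₀
  refine Pi.summable.2 fun i => Pi.summable.2 fun j => ?_
  set e : Vec nx := Pi.single i 1
  set c := e ⬝ᵥ (M *ᵥ e) / a
  have hgeo : Summable fun n : ℕ => √c * √g.β ^ n :=
    (summable_geometric_of_lt_one (Real.sqrt_nonneg _)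
      (by rw [Real.sqrt_lt' one_pos]; simpa using hβ₁)).mul_left _
  refine Summable.of_norm_bounded hgeo fun n => ?_
  have h1 : (g.Γ M ^ n) i j = g.β ^ n * (g.closedLoop M ^ n *ᵥ e) j := by
    rw [Γ_pow, Matrix.smul_apply, Matrix.transpose_apply, smul_eq_mul, Matrix.mulVec_single_one]
    rfl
  have h2 : g.β ^ n * (a * ‖g.closedLoop M ^ n *ᵥ e‖ ^ 2) ≤ e ⬝ᵥ (M *ᵥ e) := by
    have h3 := hM.sum_form_add_le hR hβ₀ e n
    have h4 : 0 ≤ ∑ n ∈ Finset.range n, g.β ^ n *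
        ((g.closedLoop M ^ n *ᵥ e) ⬝ᵥ (g.Q *ᵥ (g.closedLoop M ^ n *ᵥ e))) :=
      Finset.sum_nonneg fun n _ => mul_nonneg (pow_nonneg hβ₀ n) (hQ.posSemidef.form_nonneg _)
    have h5 := mul_le_mul_of_nonneg_left (h (g.closedLoop M ^ n *ᵥ e)) (pow_nonneg hβ₀ n)
    linarith
  have h3 : √g.β ^ n * ‖g.closedLoop M ^ n *ᵥ e‖ ≤ √c := by
    refine Real.le_sqrt_of_sq_le ?_
    rw [le_div_iff₀ ha, mul_pow, ← pow_mul, mul_comm n, pow_mul, Real.sq_sqrt hβ₀]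
    linarith
  rw [Real.norm_eq_abs, h1, abs_mul, abs_of_nonneg (pow_nonneg hβ₀ n)]
  calc g.β ^ n * |(g.closedLoop M ^ n *ᵥ e) j|
      ≤ g.β ^ n * ‖g.closedLoop M ^ n *ᵥ e‖ := by
        gcongr
        exact norm_le_pi_norm (g.closedLoop M ^ n *ᵥ e) j
    _ = (√g.β ^ n * ‖g.closedLoop M ^ n *ᵥ e‖) * √g.β ^ n := by
        rw [mul_right_comm, ← mul_pow, Real.mul_self_sqrt hβ₀]
    _ ≤ _ := by gcongr

theorem IsRiccatiSolution.isUnit_one_sub_Γ (hM : g.IsRiccatiSolution M) (hQ : g.Q.PosDef)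
    (hR : g.R.PosDef) (hβ₀ : 0 ≤ g.β) (hβ₁ : g.β < 1) : IsUnit (1 - g.Γ M) := by
  have hs := hM.summable_Γ_pow hQ hR hβ₀ hβ₁
  exact ⟨⟨_, _, hs.one_sub_mul_tsum_pow, hs.tsum_pow_mul_one_sub⟩, rfl⟩

theorem IsRiccatiSolution.hasSum_Γ_pow (hM : g.IsRiccatiSolution M) (hQ : g.Q.PosDef)
    (hR : g.R.PosDef) (hβ₀ : 0 ≤ g.β) (hβ₁ : g.β < 1) :
    HasSum (g.Γ M ^ ·) (1 - g.Γ M)⁻¹ := by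
  have hs := hM.summable_Γ_pow hQ hR hβ₀ hβ₁
  rw [Matrix.inv_eq_right_inv hs.one_sub_mul_tsum_pow]
  exact hs.hasSum

/-- The terms with `n ≥ 1` are the image of the Neumann series of `Γ` under a continuous additive
map. The closed form is what matches `G` with the constant part of the optimal control. -/
theorem IsRiccatiSolution.hasSum_Gseq (hM : g.IsRiccatiSolution M) (hQ : g.Q.PosDef)
    (hR : g.R.PosDef) (hβ₀ : 0 ≤ g.β) (hβ₁ : g.β < 1) :
    HasSum (g.Gseq M) (-((g.S M)⁻¹ * g.Kᵀ) + -(g.β • ((g.S M)⁻¹ * g.Bᵀ * (1 - g.Γ M)⁻¹ *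
      ((g.F M)ᵀ * g.Kᵀ + g.Lᵀ)))) := by
  have hs := hM.hasSum_Γ_pow hQ hR hβ₀ hβ₁
  let φ : Matrix (Fin nx) (Fin nx) ℝ →+ Matrix (Fin nu) (Fin ny) ℝ :=
    AddMonoidHom.mk' (fun X => -(g.β • ((g.S M)⁻¹ * g.Bᵀ * X * ((g.F M)ᵀ * g.Kᵀ + g.Lᵀ))))
      fun X Y => by
        simp only [Matrix.mul_add, Matrix.add_mul, smul_add, neg_add]
        abel
  have hφ : Continuous φ := by
    change Continuous fun X => -(g.β • ((g.S M)⁻¹ * g.Bᵀ * X * ((g.F M)ᵀ * g.Kᵀ + g.Lᵀ)))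
    fun_prop
  exact HasSum.zero_add (f := g.Gseq M) (hs.map φ hφ)

/-- The linear part of the value function: the fixed point equation for `p`, and the relation
between `p` and the constant part of the optimal control. -/
theorem IsRiccatiSolution.exists_linear_part (hM : g.IsRiccatiSolution M) (hQ : g.Q.PosDef)
    (hR : g.R.PosDef) (hβ₀ : 0 ≤ g.β) (hβ₁ : g.β < 1) (yhat : Vec ny) (what : Vec nx) :
    ∃ p : Vec nx,
      g.S M *ᵥ (g.G M *ᵥ yhat + g.H M what) =
        -(g.Kᵀ *ᵥ yhat + g.β • (g.Bᵀ *ᵥ (M *ᵥ what + p))) ∧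
      p = (g.F M)ᵀ *ᵥ (g.Kᵀ *ᵥ yhat) + g.Lᵀ *ᵥ yhat + g.Γ M *ᵥ (M *ᵥ what + p) := by
  have hu := hM.isUnit_one_sub_Γ hQ hR hβ₀ hβ₁
  set d : Vec nx := ((g.F M)ᵀ * g.Kᵀ + g.Lᵀ) *ᵥ yhat with hd
  -- With `v = M what + p`, the fixed point equation `p = d + Γ v` becomes `(1 - Γ) v = d + M what`.
  set v : Vec nx := (1 - g.Γ M)⁻¹ *ᵥ (d + M *ᵥ what) with hv
  have hv' : v - g.Γ M *ᵥ v = d + M *ᵥ what := by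
    have : (1 - g.Γ M) *ᵥ v = d + M *ᵥ what := by
      rw [hv, Matrix.mulVec_mulVec, Matrix.mul_nonsing_inv _
        ((Matrix.isUnit_iff_isUnit_det _).1 hu), Matrix.one_mulVec]
    simpa [Matrix.sub_mulVec] using this
  refine ⟨v - M *ᵥ what, ?_, ?_⟩
  · rw [add_sub_cancel, G, (hM.hasSum_Gseq hQ hR hβ₀ hβ₁).tsum_eq, H, hv]
    simp only [Matrix.add_mulVec, Matrix.neg_mulVec, Matrix.smul_mulVec, Matrix.mulVec_add,
      Matrix.mulVec_neg, Matrix.mulVec_smul, ← Matrix.mulVec_mulVec, S_mulVec_S_inv hR hβ₀ hM.1, hd]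
    simp only [smul_add, neg_add]
    abel
  · rw [add_sub_cancel]
    have h1 : d = (g.F M)ᵀ *ᵥ (g.Kᵀ *ᵥ yhat) + g.Lᵀ *ᵥ yhat := by
      rw [hd, Matrix.add_mulVec, Matrix.mulVec_mulVec]
    rw [← h1]
    refine sub_eq_iff_eq_add'.2 ((sub_eq_iff_eq_add'.1 hv').trans ?_)
    abel

/-- Completing the square in the Bellman equation. -/
theorem IsRiccatiSolution.bellman (hM : g.IsRiccatiSolution M) (hR : g.R.PosDef) (hβ₀ : 0 ≤ g.β)
    {yhat : Vec ny} {what p : Vec nx} {h : Vec nu}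
    (hh : g.S M *ᵥ h = -(g.Kᵀ *ᵥ yhat + g.β • (g.Bᵀ *ᵥ (M *ᵥ what + p))))
    (hp : p = (g.F M)ᵀ *ᵥ (g.Kᵀ *ᵥ yhat) + g.Lᵀ *ᵥ yhat + g.Γ M *ᵥ (M *ᵥ what + p))
    (x : Vec nx) (u : Vec nu) :
    g.stageCost x u yhat + g.β * ((g.A *ᵥ x + g.B *ᵥ u) ⬝ᵥ (M *ᵥ (g.A *ᵥ x + g.B *ᵥ u)) +
      2 * ((g.A *ᵥ x + g.B *ᵥ u) ⬝ᵥ (M *ᵥ what + p))) =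
    x ⬝ᵥ (M *ᵥ x) + 2 * (p ⬝ᵥ x) +
      (u - g.F M *ᵥ x - h) ⬝ᵥ (g.S M *ᵥ (u - g.F M *ᵥ x - h)) - h ⬝ᵥ (g.S M *ᵥ h) := by
  have h1 := one_step_form hR hβ₀ hM.1 x u
  rw [hM.riccatiMap_eq] at h1
  -- Pairing the equation for `p` with `x` and transposing `Γ` shows `p` as the linear cost of one
  -- step under `u = F x`, which is what the linear terms in `x` have to match.
  have hpx : p ⬝ᵥ x = yhat ⬝ᵥ (g.K *ᵥ (g.F M *ᵥ x)) + yhat ⬝ᵥ (g.L *ᵥ x) +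
      g.β * ((g.A *ᵥ x + g.B *ᵥ (g.F M *ᵥ x)) ⬝ᵥ (M *ᵥ what + p)) := by
    conv_lhs => rw [hp, dotProduct_comm]
    generalize M *ᵥ what + p = v
    simp only [Γ, dotProduct_add, dotProduct_mulVec_transpose, Matrix.smul_mulVec,
      dotProduct_smul, smul_eq_mul, Matrix.add_mulVec, ← Matrix.mulVec_mulVec]
    rw [dotProduct_comm yhat, dotProduct_comm yhat]
  rw [form_sub (posDef_S hR hβ₀ hM.1).posSemidef.transpose_eq (u - g.F M *ᵥ x) h, hh, hpx]
  generalize M *ᵥ what + p = v at *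
  simp only [stageCost, dotProduct_neg, dotProduct_add, dotProduct_smul, sub_dotProduct,
    smul_eq_mul, dotProduct_mulVec_transpose, add_dotProduct] at h1 ⊢
  rw [dotProduct_comm yhat, dotProduct_comm yhat, dotProduct_comm yhat]
  linarith

end Game

/-! ### Matrices acting on random vectors. -/

section MatrixVector

variable {Ω : Type*} [MeasurableSpace Ω] {μ : Measure Ω} {m n : ℕ}

/-- A matrix as a continuous linear map between spaces of vectors. -/
noncomputable def mulVecCLM (N : Matrix (Fin m) (Fin n) ℝ) : Vec n →L[ℝ] Vec m :=
  LinearMap.toContinuousLinearMap N.mulVecLin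

theorem measurable_mulVec (N : Matrix (Fin m) (Fin n) ℝ) :
    Measurable fun x : Vec n => N *ᵥ x := (mulVecCLM N).continuous.measurable

theorem memLp_mulVec (N : Matrix (Fin m) (Fin n) ℝ) {X : Ω → Vec n} {p : ℝ≥0∞}
    (hX : MemLp X p μ) : MemLp (fun ω => N *ᵥ X ω) p μ :=
  (mulVecCLM N).comp_memLp' hX

theorem integrable_mulVec (N : Matrix (Fin m) (Fin n) ℝ) {X : Ω → Vec n} (hX : Integrable X μ) :
    Integrable (fun ω => N *ᵥ X ω) μ := (mulVecCLM N).integrable_comp hX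

theorem integral_mulVec (N : Matrix (Fin m) (Fin n) ℝ) {X : Ω → Vec n} (hX : Integrable X μ) :
    ∫ ω, N *ᵥ X ω ∂μ = N *ᵥ ∫ ω, X ω ∂μ := (mulVecCLM N).integral_comp_comm hX

end MatrixVector

/-! ### State paths under the affine feedback. -/

section AffinePath

variable {nx nu ny : ℕ}

/-- The states under the affine feedback `u = F x + h`. -/
def affinePath (A : Matrix (Fin nx) (Fin nx) ℝ) (B : Matrix (Fin nx) (Fin nu) ℝ)
    (F : Matrix (Fin nu) (Fin nx) ℝ) (h : Vec nu) (x : Vec nx) (w : ℕ → Vec nx) : ℕ → Vec nx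
  | 0 => x
  | t + 1 => A *ᵥ affinePath A B F h x w t + B *ᵥ (F *ᵥ affinePath A B F h x w t + h) + w t

variable (g : Game nx nu ny) (F : Matrix (Fin nu) (Fin nx) ℝ) (h : Vec nu)

theorem control_affineStrategy (x : Vec nx) (w : ℕ → Vec nx) (z : ℕ → Vec ny) (t : ℕ) :
    g.control (affineStrategy ny F h) x w z t =
      F *ᵥ g.state (affineStrategy ny F h) x w z t + h := by
  rw [g.control_eq]
  simp [affineStrategy]

theorem state_affineStrategy (x : Vec nx) (w : ℕ → Vec nx) (z : ℕ → Vec ny) (t : ℕ) :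
    g.state (affineStrategy ny F h) x w z t = affinePath g.A g.B F h x w t := by
  induction t with
  | zero => rw [g.state_zero, affinePath]
  | succ t ih => rw [g.state_succ, control_affineStrategy, ih, affinePath]

end AffinePath

/-! ### The population under the affine feedback and the law of large numbers. -/

namespace PrimitiveAssumption

variable {Ω : Type*} {mΩ : MeasurableSpace Ω} {P : Measure Ω}
  {nx nu ny : ℕ} {x₀ : ℕ → Ω → Vec nx} {w : ℕ → ℕ → Ω → Vec nx} {ξ : ℕ → Ω → Vec ny}

/-- The sigma-algebras generated by the single primitive random vectors. -/
abbrev primitiveSigma (x₀ : ℕ → Ω → Vec nx) (w : ℕ → ℕ → Ω → Vec nx) (ξ : ℕ → Ω → Vec ny) :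
    ℕ ⊕ (ℕ × ℕ) ⊕ ℕ → MeasurableSpace Ω :=
  Sum.elim (fun i : ℕ => MeasurableSpace.comap (x₀ i) inferInstance)
    (Sum.elim (fun p : ℕ × ℕ => MeasurableSpace.comap (w p.1 p.2) inferInstance)
      (fun t : ℕ => MeasurableSpace.comap (ξ t) inferInstance))

/-- The information generated by the primitive random vectors with indices in `S`. -/
abbrev sigmaOf (x₀ : ℕ → Ω → Vec nx) (w : ℕ → ℕ → Ω → Vec nx) (ξ : ℕ → Ω → Vec ny)
    (S : Set (ℕ ⊕ (ℕ × ℕ) ⊕ ℕ)) : MeasurableSpace Ω :=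
  ⨆ i ∈ S, primitiveSigma x₀ w ξ i

/-- The common source of independence from the primitives: one only has to exhibit the disjoint sets
of primitive variables on which two random variables depend. -/
theorem indepFun_of_disjoint (hp : PrimitiveAssumption P x₀ w ξ) {S T : Set (ℕ ⊕ (ℕ × ℕ) ⊕ ℕ)}
    (hST : Disjoint S T) {α β : Type*} [MeasurableSpace α] [MeasurableSpace β] {X : Ω → α}
    {Y : Ω → β} (hX : Measurable[sigmaOf x₀ w ξ S] X) (hY : Measurable[sigmaOf x₀ w ξ T] Y) :
    IndepFun X Y P := by
  have h := indep_iSup_of_disjoint (m := primitiveSigma x₀ w ξ) (fun i => ?_) hp.indep hST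
  · exact indep_of_indep_of_le_left (indep_of_indep_of_le_right h hY.comap_le) hX.comap_le
  · rcases i with i | i | i
    · exact (hp.measurable_x₀ i).comap_le
    · exact (hp.measurable_w i.1 i.2).comap_le
    · exact (hp.measurable_ξ i).comap_le

theorem measurable_sigmaOf {S : Set (ℕ ⊕ (ℕ × ℕ) ⊕ ℕ)} {i : ℕ ⊕ (ℕ × ℕ) ⊕ ℕ} (hi : i ∈ S)
    {α : Type*} [MeasurableSpace α] {X : Ω → α}
    (hX : Measurable[primitiveSigma x₀ w ξ i] X) : Measurable[sigmaOf x₀ w ξ S] X :=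
  hX.mono (le_iSup₂ (f := fun i _ => primitiveSigma x₀ w ξ i) i hi) le_rfl

theorem measurable_x₀_sigmaOf {S : Set (ℕ ⊕ (ℕ × ℕ) ⊕ ℕ)} {i : ℕ} (hi : Sum.inl i ∈ S) :
    Measurable[sigmaOf x₀ w ξ S] (x₀ i) :=
  measurable_sigmaOf hi (comap_measurable (x₀ i))

theorem measurable_w_sigmaOf {S : Set (ℕ ⊕ (ℕ × ℕ) ⊕ ℕ)} {i t : ℕ}
    (hi : Sum.inr (Sum.inl (i, t)) ∈ S) : Measurable[sigmaOf x₀ w ξ S] (w i t) :=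
  measurable_sigmaOf hi (comap_measurable (w i t))

/-- The indices of the initial state of player `i` and of the disturbances before time `t`. -/
def indicesBefore (i t : ℕ) : Set (ℕ ⊕ (ℕ × ℕ) ⊕ ℕ) :=
  {k | k = Sum.inl i ∨ ∃ n < t, k = Sum.inr (Sum.inl (i, n))}

theorem indicesBefore_disjoint {i j : ℕ} (hij : i ≠ j) (t : ℕ) :
    Disjoint (indicesBefore i t) (indicesBefore j t) := by
  rw [Set.disjoint_left]
  rintro k (rfl | ⟨n, -, rfl⟩) (h | ⟨m, -, h⟩) <;> simp_all

theorem indicesBefore_disjoint_singleton (i t : ℕ) :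
    Disjoint (indicesBefore i t) {Sum.inr (Sum.inl (i, t))} := by
  rw [Set.disjoint_left]
  rintro k (rfl | ⟨n, hn, rfl⟩) h
  · simp at h
  · simp only [Set.mem_singleton_iff, Sum.inr.injEq, Sum.inl.injEq, Prod.mk.injEq] at h
    omega

/-- The initial state and the disturbances before time `t` are independent of the disturbance
at time `t`. -/
theorem indepFun_before (hp : PrimitiveAssumption P x₀ w ξ) (i t : ℕ) :
    IndepFun (fun ω => (x₀ i ω, fun k : Fin t => w i k ω)) (w i t) P := by
  refine hp.indepFun_of_disjoint (indicesBefore_disjoint_singleton i t) ?_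
    (measurable_w_sigmaOf rfl)
  refine Measurable.prodMk (measurable_x₀_sigmaOf (Or.inl rfl))
    (@measurable_pi_lambda _ _ _ (_) _ _ fun k => measurable_w_sigmaOf (Or.inr ⟨k, k.2, rfl⟩))

variable (A : Matrix (Fin nx) (Fin nx) ℝ) (B : Matrix (Fin nx) (Fin nu) ℝ)
  (F : Matrix (Fin nu) (Fin nx) ℝ) (h : Vec nu)

theorem iIndepFun_ξ (hp : PrimitiveAssumption P x₀ w ξ) : iIndepFun ξ P :=
  hp.indep.precomp (g := fun t : ℕ => Sum.inr (Sum.inr t))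
    (Sum.inr_injective.comp Sum.inr_injective)

variable [IsProbabilityMeasure P]

/-- The random states of player `i` under the affine feedback. -/
def affineState (x₀ : ℕ → Ω → Vec nx) (w : ℕ → ℕ → Ω → Vec nx) (i t : ℕ) (ω : Ω) : Vec nx :=
  affinePath A B F h (x₀ i ω) (fun n => w i n ω) t

theorem affineState_succ (i t : ℕ) (ω : Ω) : affineState A B F h x₀ w i (t + 1) ω =
    A *ᵥ affineState A B F h x₀ w i t ω + B *ᵥ (F *ᵥ affineState A B F h x₀ w i t ω + h) +
      w i t ω := rfl

/-- The affine feedback step. -/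
theorem measurable_affine_step : Measurable fun q : Vec nx × Vec nx =>
    A *ᵥ q.1 + B *ᵥ (F *ᵥ q.1 + h) + q.2 := by
  have : Continuous fun q : Vec nx × Vec nx => A *ᵥ q.1 + B *ᵥ (F *ᵥ q.1 + h) + q.2 := by
    fun_prop
  exact this.measurable

/-- An arbitrary superset `S` lets the induction on `t` keep one sigma-algebra although
`indicesBefore i t` grows. -/
theorem measurable_affineState_sigmaOf (i t : ℕ) {S : Set (ℕ ⊕ (ℕ × ℕ) ⊕ ℕ)}
    (hS : indicesBefore i t ⊆ S) :
    Measurable[sigmaOf x₀ w ξ S] (affineState A B F h x₀ w i t) := by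
  induction t with
  | zero =>
    change Measurable[sigmaOf x₀ w ξ S] (x₀ i)
    exact measurable_x₀_sigmaOf (hS (Or.inl rfl))
  | succ t ih =>
    have h1 := ih fun k hk => hS (by
      rcases hk with hk | ⟨n, hn, hk⟩
      · exact Or.inl hk
      · exact Or.inr ⟨n, by omega, hk⟩)
    have h2 : Measurable[sigmaOf x₀ w ξ S] (w i t) :=
      measurable_w_sigmaOf (hS (Or.inr ⟨t, by omega, rfl⟩))
    exact (measurable_affine_step A B F h).comp (h1.prodMk h2)

/-- State and current disturbance are independent, so their joint law, and with it the law of the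
next state, is determined by marginals that do not depend on the player. -/
theorem identDistrib_affineState (hp : PrimitiveAssumption P x₀ w ξ) (i t : ℕ) :
    IdentDistrib (affineState A B F h x₀ w i t) (affineState A B F h x₀ w 0 t) P P := by
  induction t with
  | zero => exact hp.ident_x₀ i
  | succ t ih =>
    have hind : ∀ j, IndepFun (affineState A B F h x₀ w j t) (w j t) P := fun j =>
      hp.indepFun_of_disjoint (indicesBefore_disjoint_singleton j t)
        (measurable_affineState_sigmaOf A B F h j t subset_rfl) (measurable_w_sigmaOf rfl)
    exact (ih.prodMk ((hp.ident_w i t).trans (hp.ident_w 0 t).symm) (hind i) (hind 0)).comp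
      (measurable_affine_step A B F h)

theorem memLp_affineState (hp : PrimitiveAssumption P x₀ w ξ) (i t : ℕ) :
    MemLp (affineState A B F h x₀ w i t) 2 P := by
  induction t with
  | zero => exact hp.memLp_x₀ i
  | succ t ih =>
    exact ((memLp_mulVec A ih).add (memLp_mulVec B ((memLp_mulVec F ih).add
      (memLp_const h)))).add (hp.memLp_w i t)

/-- The means follow the noiseless affine recursion, started at its fixed point. -/
theorem integral_affineState (hp : PrimitiveAssumption P x₀ w ξ) {xhat : Vec nx}
    (hx : xhat = A *ᵥ xhat + B *ᵥ (F *ᵥ xhat + h) + ∫ ω, w 0 0 ω ∂P)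
    (hx₀ : ∫ ω, x₀ 0 ω ∂P = xhat) (i t : ℕ) :
    ∫ ω, affineState A B F h x₀ w i t ω ∂P = xhat := by
  induction t with
  | zero => exact (hp.ident_x₀ i).integral_eq.trans hx₀
  | succ t ih =>
    have hi : Integrable (affineState A B F h x₀ w i t) P :=
      (memLp_affineState A B F h hp i t).integrable one_le_two
    have hFi : Integrable (fun ω => F *ᵥ affineState A B F h x₀ w i t ω + h) P :=
      (integrable_mulVec F hi).add (integrable_const h)
    have hw : Integrable (w i t) P := (hp.memLp_w i t).integrable one_le_two
    have hAB : Integrable (fun ω => A *ᵥ affineState A B F h x₀ w i t ω +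
        B *ᵥ (F *ᵥ affineState A B F h x₀ w i t ω + h)) P :=
      (integrable_mulVec A hi).add (integrable_mulVec B hFi)
    simp only [affineState_succ]
    rw [integral_add hAB hw,
      integral_add (integrable_mulVec A hi) (integrable_mulVec B hFi), integral_mulVec A hi,
      integral_mulVec B hFi, integral_add (integrable_mulVec F hi) (integrable_const h),
      integral_mulVec F hi, ih, integral_const, probReal_univ, one_smul,
      (hp.ident_w i t).integral_eq]
    exact hx.symm

/-- The strong law of large numbers for the averages over the players. -/
theorem tendsto_average (hp : PrimitiveAssumption P x₀ w ξ) (g : Game nx nu ny) {xhat : Vec nx}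
    (hx : xhat = g.A *ᵥ xhat + g.B *ᵥ (F *ᵥ xhat + h) + ∫ ω, w 0 0 ω ∂P)
    (hx₀ : ∫ ω, x₀ 0 ω ∂P = xhat) (t : ℕ) :
    ∀ᵐ ω ∂P, Tendsto (fun N => g.average (fun j => affineState g.A g.B F h x₀ w j t ω)
      (fun j => F *ᵥ affineState g.A g.B F h x₀ w j t ω + h) N) atTop
      (nhds (g.E1 *ᵥ (F *ᵥ xhat + h) + g.E2 *ᵥ xhat)) := by
  set φ : Vec nx → Vec ny := fun x => g.E1 *ᵥ (F *ᵥ x + h) + g.E2 *ᵥ x with hφ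
  have hφm : Measurable φ := by
    have : Continuous φ := by fun_prop
    exact this.measurable
  have hint : ∀ j, Integrable (affineState g.A g.B F h x₀ w j t) P := fun j =>
    (memLp_affineState g.A g.B F h hp j t).integrable one_le_two
  have hFint : Integrable (fun ω => F *ᵥ affineState g.A g.B F h x₀ w 0 t ω + h) P :=
    (integrable_mulVec F (hint 0)).add (integrable_const h)
  have hslln := strong_law_ae (μ := P) (fun j ω => φ (affineState g.A g.B F h x₀ w j t ω))
    ((integrable_mulVec g.E1 hFint).add (integrable_mulVec g.E2 (hint 0)))
    (fun i j hij => (hp.indepFun_of_disjoint (indicesBefore_disjoint hij t)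
      (measurable_affineState_sigmaOf g.A g.B F h i t subset_rfl)
      (measurable_affineState_sigmaOf g.A g.B F h j t subset_rfl)).comp hφm hφm)
    (fun i => (identDistrib_affineState g.A g.B F h hp i t).comp hφm)
  have hmean : ∫ ω, φ (affineState g.A g.B F h x₀ w 0 t ω) ∂P = φ xhat := by
    simp only [hφ]
    rw [integral_add (integrable_mulVec g.E1 hFint) (integrable_mulVec g.E2 (hint 0)),
      integral_mulVec g.E1 hFint, integral_mulVec g.E2 (hint 0),
      integral_add (integrable_mulVec F (hint 0)) (integrable_const h),
      integral_mulVec F (hint 0), integral_affineState g.A g.B F h hp hx hx₀, integral_const,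
      probReal_univ, one_smul]
  rw [hmean] at hslln
  exact hslln

/-- The affine feedback ignores the environment, so one null set serves all sequences `z`. This
permits inserting the generated environment itself, which is random and defined recursively. -/
theorem limsupAverage_eq (hp : PrimitiveAssumption P x₀ w ξ) (g : Game nx nu ny) {xhat : Vec nx}
    (hx : xhat = g.A *ᵥ xhat + g.B *ᵥ (F *ᵥ xhat + h) + ∫ ω, w 0 0 ω ∂P)
    (hx₀ : ∫ ω, x₀ 0 ω ∂P = xhat) :
    ∀ᵐ ω ∂P, ∀ (t : ℕ) (k : Fin ny) (z : ℕ → Vec ny),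
      g.limsupAverage (fun j => g.state (affineStrategy ny F h) (x₀ j ω) (fun n => w j n ω) z t)
        (fun j => g.control (affineStrategy ny F h) (x₀ j ω) (fun n => w j n ω) z t) k =
      ((g.E1 *ᵥ (F *ᵥ xhat + h) + g.E2 *ᵥ xhat) k : ℝ) := by
  filter_upwards [ae_all_iff.2 fun t => tendsto_average F h hp g hx hx₀ t] with ω hω t k z
  simp only [control_affineStrategy, state_affineStrategy]
  exact ((continuous_coe_real_ereal.tendsto _).comp
    (tendsto_pi_nhds.1 (hω t) k)).limsup_eq

theorem randomEnv_ae_eq (hp : PrimitiveAssumption P x₀ w ξ) (g : Game nx nu ny) {xhat : Vec nx}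
    (hx : xhat = g.A *ᵥ xhat + g.B *ᵥ (F *ᵥ xhat + h) + ∫ ω, w 0 0 ω ∂P)
    (hx₀ : ∫ ω, x₀ 0 ω ∂P = xhat) :
    ∀ᵐ ω ∂P, ∀ t, g.randomEnv x₀ w ξ (fun _ => affineStrategy ny F h) t ω =
      g.E1 *ᵥ (F *ᵥ xhat + h) + g.E2 *ᵥ xhat + ξ t ω := by
  filter_upwards [limsupAverage_eq F h hp g hx hx₀] with ω hω t
  rw [Game.randomEnv, g.env_eq]
  simp only [hω, EReal.toReal_coe]

theorem envDefined_affineStrategy (hp : PrimitiveAssumption P x₀ w ξ) (g : Game nx nu ny)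
    {xhat : Vec nx} (hx : xhat = g.A *ᵥ xhat + g.B *ᵥ (F *ᵥ xhat + h) + ∫ ω, w 0 0 ω ∂P)
    (hx₀ : ∫ ω, x₀ 0 ω ∂P = xhat) :
    g.EnvDefined P x₀ w ξ fun _ => affineStrategy ny F h := by
  filter_upwards [limsupAverage_eq F h hp g hx hx₀] with ω hω t k
  simp only [hω]
  exact ⟨EReal.coe_ne_bot _, EReal.coe_ne_top _⟩

end PrimitiveAssumption

/-! ### Extended expectations of differences. -/

section ExtendedExpectation

theorem toENNReal_neg_sub (p n : ℝ≥0∞) (hn : n ≠ ⊤) :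
    (-((p : EReal) - n)).toENNReal = n - p := by
  rw [EReal.neg_sub (by simp) (by simp [hn]), add_comm, ← sub_eq_add_neg,
    EReal.toENNReal_sub (EReal.coe_ennreal_nonneg _), EReal.toENNReal_coe, EReal.toENNReal_coe]

theorem toENNReal_sub_add (p n : ℝ≥0∞) (hn : n ≠ ⊤) :
    ((p : EReal) - n).toENNReal + n = (-((p : EReal) - n)).toENNReal + p := by
  rw [toENNReal_neg_sub p n hn, EReal.toENNReal_sub (EReal.coe_ennreal_nonneg _),
    EReal.toENNReal_coe, EReal.toENNReal_coe, tsub_add_eq_max, tsub_add_eq_max, max_comm]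

variable {Ω : Type*} [MeasurableSpace Ω] {μ : Measure Ω}

theorem extExp_congr {X Y : Ω → EReal} (h : X =ᵐ[μ] Y) : extExp μ X = extExp μ Y := by
  have h1 : ∫⁻ ω, (X ω).toENNReal ∂μ = ∫⁻ ω, (Y ω).toENNReal ∂μ :=
    lintegral_congr_ae (h.mono fun ω hω => by simp only [hω])
  have h2 : ∫⁻ ω, (-X ω).toENNReal ∂μ = ∫⁻ ω, (-Y ω).toENNReal ∂μ :=
    lintegral_congr_ae (h.mono fun ω hω => by simp only [hω])
  rw [extExp, extExp, h1, h2]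

/-- `extExp` may be computed from any decomposition `p - n` with `∫ n` finite, not only from
positive and negative parts; `∫ p` may be infinite. -/
theorem extExp_sub {p n : Ω → ℝ≥0∞} (hp : Measurable p) (hn : Measurable n)
    (hfin : ∫⁻ ω, n ω ∂μ ≠ ⊤) :
    extExp μ (fun ω => (p ω : EReal) - n ω) =
      ((∫⁻ ω, p ω ∂μ : ℝ≥0∞) : EReal) - ((∫⁻ ω, n ω ∂μ : ℝ≥0∞) : EReal) := by
  have hae : ∀ᵐ ω ∂μ, n ω ≠ ⊤ := (ae_lt_top hn hfin).mono fun ω h => h.ne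
  rw [extExp]
  set a := ∫⁻ ω, ((p ω : EReal) - n ω).toENNReal ∂μ
  set b := ∫⁻ ω, (-((p ω : EReal) - n ω)).toENNReal ∂μ
  have hb : b ≠ ⊤ := ne_top_of_le_ne_top hfin
    (lintegral_mono_ae (hae.mono fun ω h => (toENNReal_neg_sub _ _ h).trans_le tsub_le_self))
  -- Subtraction-free form of `X⁺ - X⁻ = p - n`, which can be integrated in `ℝ≥0∞`.
  have hab : a + ∫⁻ ω, n ω ∂μ = b + ∫⁻ ω, p ω ∂μ := by
    rw [← lintegral_add_right _ hn, ← lintegral_add_right _ hp]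
    exact lintegral_congr_ae (hae.mono fun ω h => toENNReal_sub_add _ _ h)
  clear_value a b
  generalize ∫⁻ ω, n ω ∂μ = N at *
  generalize ∫⁻ ω, p ω ∂μ = p' at *
  lift N to NNReal using hfin
  lift b to NNReal using hb
  rcases eq_or_ne p' ⊤ with rfl | hp'
  · have ha : a = ⊤ := by simpa using hab
    rw [ha]
    simp
  · have ha : a ≠ ⊤ := by
      rintro h
      rw [h] at hab
      have : (b : ℝ≥0∞) + p' ≠ ⊤ := by simp [hp']
      exact this (by rw [← hab]; simp)
    lift a to NNReal using ha
    lift p' to NNReal using hp'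
    have h : (a : ℝ) + N = b + p' := by exact_mod_cast hab
    have h2 : (a : ℝ) - b = p' - N := by linarith
    have h3 : (((a : ℝ) - b : ℝ) : EReal) = ((p' - N : ℝ) : EReal) := by rw [h2]
    rw [EReal.coe_sub, EReal.coe_sub] at h3
    exact h3

end ExtendedExpectation

/-! ### Independence on product spaces. -/

section Product

variable {α β : Type*} [MeasurableSpace α] [MeasurableSpace β] {μ : Measure α} {ν : Measure β}
  [IsProbabilityMeasure μ] [IsProbabilityMeasure ν] {γ δ : Type*} [MeasurableSpace γ]
  [MeasurableSpace δ]

/-- By Tonelli: with the second coordinate frozen, the event for `(X, e.2)` is an event for `X`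
alone, so independence applies slice by slice. -/
theorem indepFun_prod_fst {X : α → γ} {Y : α → δ} (h : IndepFun X Y μ) (hX : Measurable X)
    (hY : Measurable Y) :
    IndepFun (fun e : α × β => (X e.1, e.2)) (fun e => Y e.1) (μ.prod ν) := by
  have hX' : Measurable fun e : α × β => (X e.1, e.2) := by fun_prop
  have hY' : Measurable fun e : α × β => Y e.1 := by fun_prop
  rw [indepFun_iff_measure_inter_preimage_eq_mul]
  intro s t hs ht
  rw [Measure.prod_apply_symm ((hX' hs).inter (hY' ht)), Measure.prod_apply_symm (hX' hs)]
  have hT : (μ.prod ν) ((fun e : α × β => Y e.1) ⁻¹' t) = μ (Y ⁻¹' t) := by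
    have : (fun e : α × β => Y e.1) ⁻¹' t = (Y ⁻¹' t) ×ˢ Set.univ := by ext; simp
    rw [this, Measure.prod_prod, measure_univ, mul_one]
  rw [hT, ← lintegral_mul_const _ (measurable_measure_prodMk_right (hX' hs))]
  refine lintegral_congr fun y => ?_
  exact (indepFun_iff_measure_inter_preimage_eq_mul.1 h) _ t (measurable_prodMk_right hs) ht

theorem indepFun_prod_snd {X : β → γ} {Y : β → δ} (h : IndepFun X Y ν) (hX : Measurable X)
    (hY : Measurable Y) :
    IndepFun (fun e : α × β => (e.1, X e.2)) (fun e => Y e.2) (μ.prod ν) := by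
  have hX' : Measurable fun e : α × β => (e.1, X e.2) := by fun_prop
  have hY' : Measurable fun e : α × β => Y e.2 := by fun_prop
  rw [indepFun_iff_measure_inter_preimage_eq_mul]
  intro s t hs ht
  rw [Measure.prod_apply ((hX' hs).inter (hY' ht)), Measure.prod_apply (hX' hs)]
  have hT : (μ.prod ν) ((fun e : α × β => Y e.2) ⁻¹' t) = ν (Y ⁻¹' t) := by
    have : (fun e : α × β => Y e.2) ⁻¹' t = Set.univ ×ˢ (Y ⁻¹' t) := by ext; simp
    rw [this, Measure.prod_prod, measure_univ, one_mul]
  rw [hT, ← lintegral_mul_const _ (measurable_measure_prodMk_left (hX' hs))]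
  refine lintegral_congr fun x => ?_
  exact (indepFun_iff_measure_inter_preimage_eq_mul.1 h) _ t (measurable_prodMk_left hs) ht

end Product

/-! ### Expectations of bilinear forms. -/

section Forms

variable {Ω : Type*} [MeasurableSpace Ω] {μ : Measure Ω} {m n : ℕ}

theorem integrable_norm_mul_norm {X : Ω → Vec m} {Y : Ω → Vec n} (hX : MemLp X 2 μ)
    (hY : MemLp Y 2 μ) : Integrable (fun ω => ‖X ω‖ * ‖Y ω‖) μ :=
  hX.norm.integrable_mul hY.norm

theorem integrable_form (N : Matrix (Fin m) (Fin n) ℝ) {X : Ω → Vec m} {Y : Ω → Vec n}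
    (hX : MemLp X 2 μ) (hY : MemLp Y 2 μ) : Integrable (fun ω => X ω ⬝ᵥ (N *ᵥ Y ω)) μ := by
  obtain ⟨C, -, hC⟩ := exists_abs_dotProduct_mulVec_le N
  have hcont : Continuous fun q : Vec m × Vec n => q.1 ⬝ᵥ (N *ᵥ q.2) := by fun_prop
  refine ((integrable_norm_mul_norm hX hY).const_mul C).mono'
    (hcont.comp_aestronglyMeasurable (hX.1.prodMk hY.1)) (.of_forall fun ω => ?_)
  simpa [mul_assoc] using hC (X ω) (Y ω)

theorem integrable_dotProduct {X Y : Ω → Vec n} (hX : MemLp X 2 μ) (hY : MemLp Y 2 μ) :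
    Integrable (fun ω => X ω ⬝ᵥ Y ω) μ := by
  simpa using integrable_form (1 : Matrix (Fin n) (Fin n) ℝ) hX hY

theorem integral_dotProduct_of_indepFun {X Y : Ω → Vec n} (hX : Integrable X μ)
    (hY : Integrable Y μ) (h : IndepFun X Y μ) :
    ∫ ω, X ω ⬝ᵥ Y ω ∂μ = (∫ ω, X ω ∂μ) ⬝ᵥ ∫ ω, Y ω ∂μ := by
  have hXi : ∀ i, Integrable (fun ω => X ω i) μ := fun i => hX.eval i
  have hYi : ∀ i, Integrable (fun ω => Y ω i) μ := fun i => hY.eval i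
  have hi : ∀ i, IndepFun (fun ω => X ω i) (fun ω => Y ω i) μ := fun i =>
    h.comp (measurable_pi_apply i) (measurable_pi_apply i)
  simp only [dotProduct]
  have hXY : ∀ i, Integrable (fun ω => X ω i * Y ω i) μ := fun i =>
    (hi i).integrable_mul (hXi i) (hYi i)
  rw [integral_finsetSum _ fun i _ => hXY i]
  refine Finset.sum_congr rfl fun i _ => ?_
  rw [(hi i).integral_fun_mul_eq_mul_integral (hXi i).1 (hYi i).1,
    eval_integral hXi, eval_integral hYi]

theorem integral_dotProduct_const {X : Ω → Vec n} (hX : Integrable X μ) (v : Vec n) :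
    ∫ ω, X ω ⬝ᵥ v ∂μ = (∫ ω, X ω ∂μ) ⬝ᵥ v := by
  have hXi : ∀ i, Integrable (fun ω => X ω i) μ := fun i => hX.eval i
  simp only [dotProduct]
  rw [integral_finsetSum _ fun i _ => (hXi i).mul_const _]
  refine Finset.sum_congr rfl fun i _ => ?_
  rw [integral_mul_const, eval_integral hXi]

end Forms

/-! ### Series of expectations. -/

section Series

variable {Ω : Type*} [MeasurableSpace Ω] {μ : Measure Ω}

theorem integrable_of_lintegral_pos_neg {f : Ω → ℝ} (hf : Measurable f)
    (hp : ∫⁻ ω, ENNReal.ofReal (f ω) ∂μ ≠ ⊤) (hn : ∫⁻ ω, ENNReal.ofReal (-f ω) ∂μ ≠ ⊤) :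
    Integrable f μ := by
  refine ⟨hf.aestronglyMeasurable, ?_⟩
  rw [hasFiniteIntegral_iff_norm]
  have h : ∀ ω, ENNReal.ofReal ‖f ω‖ = ENNReal.ofReal (f ω) + ENNReal.ofReal (-f ω) := fun ω => by
    rcases le_total 0 (f ω) with h | h
    · rw [Real.norm_of_nonneg h, ENNReal.ofReal_of_nonpos (p := -f ω) (by linarith), add_zero]
    · rw [Real.norm_of_nonpos h, ENNReal.ofReal_of_nonpos h, zero_add]
  simp only [h]
  rw [lintegral_add_left hf.ennreal_ofReal]
  exact ENNReal.add_lt_top.2 ⟨hp.lt_top, hn.lt_top⟩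

/-- A series of random variables whose positive and negative parts have finite total expectation. -/
theorem hasSum_integral_of_pos_neg {f : ℕ → Ω → ℝ} (hf : ∀ t, Measurable (f t))
    (hp : ∑' t, ∫⁻ ω, ENNReal.ofReal (f t ω) ∂μ ≠ ⊤)
    (hn : ∑' t, ∫⁻ ω, ENNReal.ofReal (-f t ω) ∂μ ≠ ⊤) :
    (∀ t, Integrable (f t) μ) ∧ HasSum (fun t => ∫ ω, f t ω ∂μ)
      ((∑' t, ∫⁻ ω, ENNReal.ofReal (f t ω) ∂μ).toReal -
        (∑' t, ∫⁻ ω, ENNReal.ofReal (-f t ω) ∂μ).toReal) := by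
  have hpt := ENNReal.ne_top_of_tsum_ne_top hp
  have hnt := ENNReal.ne_top_of_tsum_ne_top hn
  have hi : ∀ t, Integrable (f t) μ := fun t =>
    integrable_of_lintegral_pos_neg (hf t) (hpt t) (hnt t)
  refine ⟨hi, ?_⟩
  have h1 := (ENNReal.hasSum_toReal hp).sub (ENNReal.hasSum_toReal hn)
  rw [ENNReal.tsum_toReal_eq hpt, ENNReal.tsum_toReal_eq hnt]
  refine h1.congr_fun fun t => ?_
  exact (integral_eq_lintegral_pos_part_sub_lintegral_neg_part (hi t))

/-- Each positive part has expectation equal to the integral plus that of the negative part, so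
partial sums are at most `c` plus the finite negative total. It shows that the affine feedback has
finite cost. -/
theorem tsum_lintegral_pos_ne_top {f : ℕ → Ω → ℝ} (hf : ∀ t, Integrable (f t) μ)
    (hn : ∑' t, ∫⁻ ω, ENNReal.ofReal (-f t ω) ∂μ ≠ ⊤) {c : ℝ}
    (hc : ∀ T, ∑ t ∈ Finset.range T, ∫ ω, f t ω ∂μ ≤ c) :
    ∑' t, ∫⁻ ω, ENNReal.ofReal (f t ω) ∂μ ≠ ⊤ := by
  set N := ∑' t, ∫⁻ ω, ENNReal.ofReal (-f t ω) ∂μ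
  have hnt := ENNReal.ne_top_of_tsum_ne_top hn
  have hpt : ∀ t, ∫⁻ ω, ENNReal.ofReal (f t ω) ∂μ ≠ ⊤ := fun t => by
    have := (hf t).lintegral_lt_top
    exact this.ne
  refine ne_top_of_le_ne_top (ENNReal.ofReal_ne_top (r := c + N.toReal))
    (ENNReal.tsum_le_of_sum_range_le fun T => ?_)
  rw [← ENNReal.ofReal_toReal (ENNReal.sum_ne_top.2 fun t _ => hpt t)]
  refine ENNReal.ofReal_le_ofReal ?_
  rw [ENNReal.toReal_sum fun t _ => hpt t]
  have h1 : ∀ t, (∫⁻ ω, ENNReal.ofReal (f t ω) ∂μ).toReal =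
      ∫ ω, f t ω ∂μ + (∫⁻ ω, ENNReal.ofReal (-f t ω) ∂μ).toReal := fun t => by
    rw [integral_eq_lintegral_pos_part_sub_lintegral_neg_part (hf t)]
    ring
  simp only [h1, Finset.sum_add_distrib]
  gcongr
  · exact hc T
  · rw [← ENNReal.toReal_sum fun t _ => hnt t]
    exact ENNReal.toReal_mono hn (ENNReal.sum_le_tsum _)

end Series

/-! ### Paths of a general strategy, coercivity of the cost, and the Bellman equation in
expectation. -/

namespace Game

variable {nx nu ny : ℕ} {g : Game nx nu ny}

section Path

theorem measurable_state_control (s : Strategy nx nu ny) (t : ℕ) :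
    (Measurable fun q : Vec nx × (ℕ → Vec nx) × (ℕ → Vec ny) => g.state s q.1 q.2.1 q.2.2 t) ∧
    Measurable fun q : Vec nx × (ℕ → Vec nx) × (ℕ → Vec ny) => g.control s q.1 q.2.1 q.2.2 t := by
  induction t using Nat.strong_induction_on with
  | _ t ih =>
    have hstate : Measurable fun q : Vec nx × (ℕ → Vec nx) × (ℕ → Vec ny) =>
        g.state s q.1 q.2.1 q.2.2 t := by
      cases t with
      | zero =>
        simp only [g.state_zero]
        exact measurable_fst
      | succ t =>
        obtain ⟨h1, h2⟩ := ih t (Nat.lt_succ_self t)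
        simp only [g.state_succ]
        exact (((measurable_mulVec g.A).comp h1).add ((measurable_mulVec g.B).comp h2)).add
          ((measurable_pi_apply t).comp (measurable_fst.comp measurable_snd))
    refine ⟨hstate, ?_⟩
    simp only [g.control_eq s _ _ _ t]
    refine (s.measurable_act t).comp (Measurable.prodMk (measurable_pi_lambda _ fun k => ?_)
      (Measurable.prodMk (measurable_pi_lambda _ fun k => (ih k k.2).2)
        (measurable_pi_lambda _ fun k =>
          (measurable_pi_apply _).comp (measurable_snd.comp measurable_snd))))
    rcases (Nat.lt_succ_iff.1 k.2).lt_or_eq with hk | hk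
    · exact (ih k hk).1
    · rw [hk]
      exact hstate

/-- Nonanticipativity: data from time `t` on may be replaced by zeros, which expresses state and
control as functions of variables independent of `w t` and `z t`. -/
theorem state_control_congr (s : Strategy nx nu ny) (x : Vec nx) {w w' : ℕ → Vec nx}
    {z z' : ℕ → Vec ny} (t : ℕ) (hw : ∀ k < t, w k = w' k) (hz : ∀ k < t, z k = z' k) :
    g.state s x w z t = g.state s x w' z' t ∧ g.control s x w z t = g.control s x w' z' t := by
  induction t using Nat.strong_induction_on with
  | _ t ih =>
    have ih' : ∀ k < t, g.state s x w z k = g.state s x w' z' k ∧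
        g.control s x w z k = g.control s x w' z' k := fun k hk =>
      ih k hk (fun j hj => hw j (hj.trans hk)) fun j hj => hz j (hj.trans hk)
    have hstate : g.state s x w z t = g.state s x w' z' t := by
      cases t with
      | zero => rw [g.state_zero, g.state_zero]
      | succ t =>
        have h := ih' t (Nat.lt_succ_self t)
        rw [g.state_succ, g.state_succ, h.1, h.2, hw t (Nat.lt_succ_self t)]
    refine ⟨hstate, ?_⟩
    rw [g.control_eq, g.control_eq]
    congr 1
    refine Prod.ext (funext fun k => ?_) (Prod.ext (funext fun k => (ih' k k.2).2)
      (funext fun k => hz k k.2))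
    rcases (Nat.lt_succ_iff.1 k.2).lt_or_eq with hk | hk
    · exact (ih' k hk).1
    · change g.state s x w z k = g.state s x w' z' k
      rw [hk]
      exact hstate

/-- Extension of a finite sequence by zero. -/
def extendZero {n : ℕ} (t : ℕ) (v : Fin t → Vec n) (k : ℕ) : Vec n :=
  if h : k < t then v ⟨k, h⟩ else 0

theorem measurable_extendZero {n : ℕ} (t : ℕ) : Measurable (extendZero (n := n) t) := by
  refine measurable_pi_lambda _ fun k => ?_
  by_cases h : k < t
  · simp only [extendZero, h, dif_pos]
    exact measurable_pi_apply _
  · simp only [extendZero, h, dif_neg, not_false_eq_true]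
    exact measurable_const

theorem extendZero_apply {n : ℕ} (t : ℕ) (v : ℕ → Vec n) {k : ℕ} (hk : k < t) :
    extendZero t (fun k : Fin t => v k) k = v k := by
  simp [extendZero, hk]

end Path

section Cost

/-- The stage cost is bounded below up to a multiple of the squared environment variable. -/
theorem exists_le_stageCost (hQ : g.Q.PosDef) (hR : g.R.PosDef) :
    ∃ a D : ℝ, 0 < a ∧ 0 ≤ D ∧ ∀ (x : Vec nx) (u : Vec nu) (y : Vec ny),
      a * (‖x‖ ^ 2 + ‖u‖ ^ 2) - D * ‖y‖ ^ 2 ≤ g.stageCost x u y := by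
  obtain ⟨a, ha, hax⟩ := hQ.exists_le_form
  obtain ⟨b, hb, hbu⟩ := hR.exists_le_form
  obtain ⟨k, hk, hK⟩ := exists_abs_dotProduct_mulVec_le g.K
  obtain ⟨l, hl, hL⟩ := exists_abs_dotProduct_mulVec_le g.L
  -- Half of each coercivity constant is spent on absorbing the cross terms by Young's inequality,
  -- which leaves the stated multiples of `‖y‖²`.
  refine ⟨min a b / 2, 2 * k ^ 2 / b + 2 * l ^ 2 / a, by positivity, by positivity,
    fun x u y => ?_⟩
  have h1 := neg_le_of_abs_le (hK y u)
  have h2 := neg_le_of_abs_le (hL y x)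
  have h3 : 2 * (k * ‖y‖ * ‖u‖) ≤ b / 2 * ‖u‖ ^ 2 + 2 * k ^ 2 / b * ‖y‖ ^ 2 := by
    have : b / 2 * ‖u‖ ^ 2 + 2 * k ^ 2 / b * ‖y‖ ^ 2 - 2 * (k * ‖y‖ * ‖u‖) =
        (b * ‖u‖ - 2 * k * ‖y‖) ^ 2 / (2 * b) := by
      field_simp
      ring
    have h : 0 ≤ (b * ‖u‖ - 2 * k * ‖y‖) ^ 2 / (2 * b) := by positivity
    linarith
  have h4 : 2 * (l * ‖y‖ * ‖x‖) ≤ a / 2 * ‖x‖ ^ 2 + 2 * l ^ 2 / a * ‖y‖ ^ 2 := by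
    have : a / 2 * ‖x‖ ^ 2 + 2 * l ^ 2 / a * ‖y‖ ^ 2 - 2 * (l * ‖y‖ * ‖x‖) =
        (a * ‖x‖ - 2 * l * ‖y‖) ^ 2 / (2 * a) := by
      field_simp
      ring
    have h : 0 ≤ (a * ‖x‖ - 2 * l * ‖y‖) ^ 2 / (2 * a) := by positivity
    linarith
  have h5 : min a b / 2 * ‖x‖ ^ 2 ≤ a / 2 * ‖x‖ ^ 2 := by gcongr; exact min_le_left _ _
  have h6 : min a b / 2 * ‖u‖ ^ 2 ≤ b / 2 * ‖u‖ ^ 2 := by gcongr; exact min_le_right _ _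
  have h7 := hax x
  have h8 := hbu u
  rw [stageCost, dotProduct_add]
  rw [mul_add, add_mul]
  linarith

theorem continuous_stageCost : Continuous fun q : Vec nx × Vec nu × Vec ny =>
    g.stageCost q.1 q.2.1 q.2.2 := by
  unfold stageCost
  fun_prop

/-- A quadratic value function. -/
def valueFn (M : Matrix (Fin nx) (Fin nx) ℝ) (p : Vec nx) (r : ℝ) (x : Vec nx) : ℝ :=
  x ⬝ᵥ (M *ᵥ x) + 2 * (p ⬝ᵥ x) + r

theorem exists_abs_dotProduct_le (p : Vec nx) :
    ∃ C : ℝ, 0 ≤ C ∧ ∀ x : Vec nx, |p ⬝ᵥ x| ≤ C * ‖x‖ := by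
  obtain ⟨C, hC0, hC⟩ := exists_abs_dotProduct_mulVec_le (1 : Matrix (Fin nx) (Fin nx) ℝ)
  exact ⟨C * ‖p‖, by positivity, fun x => by simpa using hC p x⟩

theorem exists_valueFn_le (M : Matrix (Fin nx) (Fin nx) ℝ) (p : Vec nx) (r : ℝ) :
    ∃ C : ℝ, 0 ≤ C ∧ ∀ x : Vec nx, valueFn M p r x ≤ C * (‖x‖ ^ 2 + 1) := by
  obtain ⟨C, hC0, hC⟩ := exists_abs_dotProduct_mulVec_le M
  obtain ⟨D, hD0, hD⟩ := exists_abs_dotProduct_le p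
  refine ⟨C + D + |r|, by positivity, fun x => ?_⟩
  have h1 := le_of_abs_le (hC x x)
  have h2 := le_of_abs_le (hD x)
  have h3 := le_abs_self r
  have h4 : 2 * (D * ‖x‖) ≤ D * (‖x‖ ^ 2 + 1) := by nlinarith [sq_nonneg (‖x‖ - 1)]
  have h5 : |r| ≤ |r| * (‖x‖ ^ 2 + 1) := by nlinarith [abs_nonneg r, sq_nonneg ‖x‖]
  rw [valueFn]
  nlinarith

theorem exists_le_valueFn {M : Matrix (Fin nx) (Fin nx) ℝ} {a : ℝ} (ha : 0 < a)
    (hM : ∀ x : Vec nx, a * ‖x‖ ^ 2 ≤ x ⬝ᵥ (M *ᵥ x)) (p : Vec nx) (r : ℝ) :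
    ∃ C : ℝ, 0 ≤ C ∧ ∀ x : Vec nx, -C ≤ valueFn M p r x := by
  obtain ⟨D, hD0, hD⟩ := exists_abs_dotProduct_le p
  refine ⟨D ^ 2 / a + |r|, by positivity, fun x => ?_⟩
  have h1 := hM x
  have h2 := neg_le_of_abs_le (hD x)
  have h3 := neg_abs_le r
  have h4 : 2 * (D * ‖x‖) ≤ a * ‖x‖ ^ 2 + D ^ 2 / a := by
    have : a * ‖x‖ ^ 2 + D ^ 2 / a - 2 * (D * ‖x‖) = (a * ‖x‖ - D) ^ 2 / a := by
      field_simp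
      ring
    have h : 0 ≤ (a * ‖x‖ - D) ^ 2 / a := by positivity
    linarith
  rw [valueFn]
  linarith

end Cost

section Bellman

variable {Ω : Type*} [MeasurableSpace Ω] {μ : Measure Ω}
  {X : Ω → Vec nx} {U : Ω → Vec nu} {Z : Ω → Vec ny} {W : Ω → Vec nx}

theorem integrable_stageCost (hX : MemLp X 2 μ) (hU : MemLp U 2 μ) (hZ : MemLp Z 2 μ) :
    Integrable (fun ω => g.stageCost (X ω) (U ω) (Z ω)) μ :=
  ((integrable_form g.Q hX hX).add (integrable_form g.R hU hU)).add
    ((integrable_dotProduct hZ ((memLp_mulVec g.K hU).add (memLp_mulVec g.L hX))).const_mul 2)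

variable [IsProbabilityMeasure μ]

theorem integrable_valueFn (M : Matrix (Fin nx) (Fin nx) ℝ) (p : Vec nx) (r : ℝ)
    (hX : MemLp X 2 μ) : Integrable (fun ω => valueFn M p r (X ω)) μ :=
  ((integrable_form M hX hX).add ((integrable_dotProduct (memLp_const p) hX).const_mul 2)).add
    (integrable_const r)

/-- The environment enters the cost linearly, so the expectation of the cross term factors. This
certainty equivalence reduces a random environment to its mean. -/
theorem integral_stageCost_of_indepFun (hX : MemLp X 2 μ) (hU : MemLp U 2 μ) (hZ : MemLp Z 2 μ)
    (h : IndepFun (fun ω => (X ω, U ω)) Z μ) :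
    ∫ ω, g.stageCost (X ω) (U ω) (Z ω) ∂μ = ∫ ω, g.stageCost (X ω) (U ω) (∫ ω, Z ω ∂μ) ∂μ := by
  have hKL : MemLp (fun ω => g.K *ᵥ U ω + g.L *ᵥ X ω) 2 μ :=
    (memLp_mulVec g.K hU).add (memLp_mulVec g.L hX)
  have hind : IndepFun Z (fun ω => g.K *ᵥ U ω + g.L *ᵥ X ω) μ := by
    have hm : Measurable fun q : Vec nx × Vec nu => g.K *ᵥ q.2 + g.L *ᵥ q.1 :=
      ((measurable_mulVec g.K).comp measurable_snd).add
        ((measurable_mulVec g.L).comp measurable_fst)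
    exact (h.comp hm measurable_id).symm
  have hq : Integrable (fun ω => X ω ⬝ᵥ (g.Q *ᵥ X ω) + U ω ⬝ᵥ (g.R *ᵥ U ω)) μ :=
    (integrable_form g.Q hX hX).add (integrable_form g.R hU hU)
  simp only [stageCost]
  rw [integral_add hq ((integrable_dotProduct hZ hKL).const_mul 2),
    integral_add hq ((integrable_dotProduct (memLp_const _) hKL).const_mul 2),
    integral_const_mul, integral_const_mul,
    integral_dotProduct_of_indepFun (hZ.integrable one_le_two) (hKL.integrable one_le_two) hind]
  simp only [dotProduct_comm (∫ ω, Z ω ∂μ)]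
  rw [integral_dotProduct_const (hKL.integrable one_le_two)]

/-- By independence the cross term involves only the mean of `W`, which produces the vector `M E[W]
+ p` of the Bellman equation; the rest does not depend on `X`. -/
theorem integral_valueFn_add {M : Matrix (Fin nx) (Fin nx) ℝ} (hM : Mᵀ = M) (p : Vec nx) (r : ℝ)
    (hX : MemLp X 2 μ) (hW : MemLp W 2 μ) (h : IndepFun X W μ) :
    ∫ ω, valueFn M p r (X ω + W ω) ∂μ =
      ∫ ω, (X ω ⬝ᵥ (M *ᵥ X ω) + 2 * (X ω ⬝ᵥ (M *ᵥ (∫ ω, W ω ∂μ) + p))) ∂μ +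
        (∫ ω, W ω ⬝ᵥ (M *ᵥ W ω) ∂μ + 2 * (p ⬝ᵥ ∫ ω, W ω ∂μ) + r) := by
  have hXi := hX.integrable one_le_two
  have hWi := hW.integrable one_le_two
  have hMW : MemLp (fun ω => M *ᵥ W ω) 2 μ := memLp_mulVec M hW
  have hind : IndepFun X (fun ω => M *ᵥ W ω) μ := h.comp measurable_id (measurable_mulVec M)
  have i1 : Integrable (fun ω => X ω ⬝ᵥ (M *ᵥ X ω)) μ := integrable_form M hX hX
  have i2 : Integrable (fun ω => X ω ⬝ᵥ (M *ᵥ W ω)) μ := integrable_form M hX hW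
  have i3 : Integrable (fun ω => X ω ⬝ᵥ p) μ := integrable_dotProduct hX (memLp_const p)
  have i4 : Integrable (fun ω => W ω ⬝ᵥ (M *ᵥ W ω)) μ := integrable_form M hW hW
  have i5 : Integrable (fun ω => W ω ⬝ᵥ p) μ := integrable_dotProduct hW (memLp_const p)
  have i6 : Integrable (fun ω => X ω ⬝ᵥ (M *ᵥ (∫ ω, W ω ∂μ) + p)) μ :=
    integrable_dotProduct hX (memLp_const _)
  have hexp : ∀ ω, valueFn M p r (X ω + W ω) = X ω ⬝ᵥ (M *ᵥ X ω) +
      (2 * (X ω ⬝ᵥ (M *ᵥ W ω)) + (2 * (X ω ⬝ᵥ p) + (W ω ⬝ᵥ (M *ᵥ W ω) +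
        (2 * (W ω ⬝ᵥ p) + r)))) := fun ω => by
    rw [valueFn, form_add hM, dotProduct_add, dotProduct_comm p, dotProduct_comm p]
    ring
  have j1 : Integrable (fun ω => 2 * (W ω ⬝ᵥ p) + r) μ :=
    (i5.const_mul 2).add (integrable_const r)
  have j2 : Integrable (fun ω => W ω ⬝ᵥ (M *ᵥ W ω) + (2 * (W ω ⬝ᵥ p) + r)) μ := i4.add j1
  have j3 : Integrable (fun ω => 2 * (X ω ⬝ᵥ p) + (W ω ⬝ᵥ (M *ᵥ W ω) +
    (2 * (W ω ⬝ᵥ p) + r))) μ := (i3.const_mul 2).add j2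
  have j4 : Integrable (fun ω => 2 * (X ω ⬝ᵥ (M *ᵥ W ω)) + (2 * (X ω ⬝ᵥ p) +
    (W ω ⬝ᵥ (M *ᵥ W ω) + (2 * (W ω ⬝ᵥ p) + r)))) μ := (i2.const_mul 2).add j3
  simp only [hexp]
  rw [integral_add i1 j4, integral_add (i2.const_mul 2) j3, integral_add (i3.const_mul 2) j2,
    integral_add i4 j1, integral_add (i5.const_mul 2) (integrable_const r),
    integral_add i1 (i6.const_mul 2), integral_const_mul, integral_const_mul, integral_const_mul,
    integral_const_mul, integral_const, probReal_univ, one_smul,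
    integral_dotProduct_of_indepFun hXi (hMW.integrable one_le_two) hind,
    integral_mulVec M hWi, integral_dotProduct_const hXi, integral_dotProduct_const hXi,
    integral_dotProduct_const hWi, dotProduct_add, dotProduct_comm p]
  ring

/-- The Bellman equation in expectation: the expected one-step loss of a control with respect to
the affine feedback is a quadratic form in the difference. -/
theorem IsRiccatiSolution.integral_bellman {M : Matrix (Fin nx) (Fin nx) ℝ}
    (hM : g.IsRiccatiSolution M) (hR : g.R.PosDef) (hβ₀ : 0 ≤ g.β)
    {p : Vec nx} {h : Vec nu} {r : ℝ}
    (hh : g.S M *ᵥ h =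
      -(g.Kᵀ *ᵥ (∫ ω, Z ω ∂μ) + g.β • (g.Bᵀ *ᵥ (M *ᵥ (∫ ω, W ω ∂μ) + p))))
    (hp : p = (g.F M)ᵀ *ᵥ (g.Kᵀ *ᵥ (∫ ω, Z ω ∂μ)) + g.Lᵀ *ᵥ (∫ ω, Z ω ∂μ) +
      g.Γ M *ᵥ (M *ᵥ (∫ ω, W ω ∂μ) + p))
    (hr : r = g.β * (∫ ω, W ω ⬝ᵥ (M *ᵥ W ω) ∂μ + 2 * (p ⬝ᵥ ∫ ω, W ω ∂μ) + r) -
      h ⬝ᵥ (g.S M *ᵥ h))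
    (hX : MemLp X 2 μ) (hU : MemLp U 2 μ) (hZ : MemLp Z 2 μ) (hW : MemLp W 2 μ)
    (hXZ : IndepFun (fun ω => (X ω, U ω)) Z μ) (hXW : IndepFun (fun ω => (X ω, U ω)) W μ) :
    ∫ ω, g.stageCost (X ω) (U ω) (Z ω) ∂μ +
      g.β * ∫ ω, valueFn M p r (g.A *ᵥ X ω + g.B *ᵥ U ω + W ω) ∂μ =
    ∫ ω, valueFn M p r (X ω) ∂μ +
      ∫ ω, (U ω - g.F M *ᵥ X ω - h) ⬝ᵥ (g.S M *ᵥ (U ω - g.F M *ᵥ X ω - h)) ∂μ := by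
  have hY : MemLp (fun ω => g.A *ᵥ X ω + g.B *ᵥ U ω) 2 μ :=
    (memLp_mulVec g.A hX).add (memLp_mulVec g.B hU)
  have hYW : IndepFun (fun ω => g.A *ᵥ X ω + g.B *ᵥ U ω) W μ := by
    have hm : Measurable fun q : Vec nx × Vec nu => g.A *ᵥ q.1 + g.B *ᵥ q.2 :=
      ((measurable_mulVec g.A).comp measurable_fst).add
        ((measurable_mulVec g.B).comp measurable_snd)
    exact hXW.comp hm measurable_id
  have hD : MemLp (fun ω => U ω - g.F M *ᵥ X ω - h) 2 μ :=
    (hU.sub (memLp_mulVec (g.F M) hX)).sub (memLp_const h)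
  have hV : Integrable (fun ω => (g.A *ᵥ X ω + g.B *ᵥ U ω) ⬝ᵥ
      (M *ᵥ (g.A *ᵥ X ω + g.B *ᵥ U ω)) +
      2 * ((g.A *ᵥ X ω + g.B *ᵥ U ω) ⬝ᵥ (M *ᵥ (∫ ω, W ω ∂μ) + p))) μ :=
    (integrable_form M hY hY).add ((integrable_dotProduct hY (memLp_const _)).const_mul 2)
  rw [integral_stageCost_of_indepFun hX hU hZ hXZ,
    integral_valueFn_add hM.1.transpose_eq p r hY hW hYW, mul_add, ← add_assoc,
    ← integral_const_mul, ← integral_add (integrable_stageCost hX hU (memLp_const _))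
      (hV.const_mul g.β),
    ← integral_add (integrable_valueFn M p r hX) (integrable_form (g.S M) hD hD)]
  simp only [hM.bellman hR hβ₀ hh hp]
  have hfin : Integrable (fun ω => valueFn M p r (X ω) +
      (U ω - g.F M *ᵥ X ω - h) ⬝ᵥ (g.S M *ᵥ (U ω - g.F M *ᵥ X ω - h))) μ :=
    (integrable_valueFn M p r hX).add (integrable_form (g.S M) hD hD)
  have hcongr : ∀ ω, X ω ⬝ᵥ (M *ᵥ X ω) + 2 * (p ⬝ᵥ X ω) +
      (U ω - g.F M *ᵥ X ω - h) ⬝ᵥ (g.S M *ᵥ (U ω - g.F M *ᵥ X ω - h)) - h ⬝ᵥ (g.S M *ᵥ h) =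
      (valueFn M p r (X ω) +
        (U ω - g.F M *ᵥ X ω - h) ⬝ᵥ (g.S M *ᵥ (U ω - g.F M *ᵥ X ω - h))) -
      (r + h ⬝ᵥ (g.S M *ᵥ h)) := fun ω => by
    rw [valueFn]
    ring
  simp only [hcongr]
  rw [integral_sub hfin (integrable_const _), integral_const, probReal_univ, one_smul]
  linarith

end Bellman

end Game

/-- The setting of a single player: initial state and disturbances with finite second moments,
identically distributed disturbances which are independent of the past, and a belief under which
the environment variables are identically distributed, independent of the past, and have finite
second moments. -/
structure PlayerAssumption {Ω : Type*} [MeasurableSpace Ω] (P : Measure Ω) {nx ny : ℕ}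
    (ζ : Measure (ℕ → Vec ny)) (x₀ : Ω → Vec nx) (w : ℕ → Ω → Vec nx) : Prop where
  measurable_x₀ : Measurable x₀
  measurable_w : ∀ t, Measurable (w t)
  memLp_x₀ : MemLp x₀ 2 P
  memLp_w : ∀ t, MemLp (w t) 2 P
  ident_w : ∀ t, IdentDistrib (w t) (w 0) P P
  indep_w : ∀ t, IndepFun (fun ω => (x₀ ω, fun k : Fin t => w k ω)) (w t) P
  memLp_z : ∀ t, MemLp (fun z : ℕ → Vec ny => z t) 2 ζ
  ident_z : ∀ t, IdentDistrib (fun z : ℕ → Vec ny => z t) (fun z => z 0) ζ ζ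
  indep_z : ∀ t, IndepFun (fun (z : ℕ → Vec ny) (k : Fin t) => z k) (fun z => z t) ζ

/-! ### Optimality of the affine feedback for a single player. -/

namespace PlayerAssumption

open Game

variable {Ω : Type*} {nx nu ny : ℕ} {g : Game nx nu ny} {ζ : Measure (ℕ → Vec ny)}
  {x₀ : Ω → Vec nx} {w : ℕ → Ω → Vec nx}

/-- The state as a random variable on the product of the belief and the noise space. -/
def jointState (g : Game nx nu ny) (x₀ : Ω → Vec nx) (w : ℕ → Ω → Vec nx)
    (s : Strategy nx nu ny) (t : ℕ) (e : (ℕ → Vec ny) × Ω) : Vec nx :=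
  g.state s (x₀ e.2) (fun n => w n e.2) e.1 t

/-- The control as a random variable on the product of the belief and the noise space. -/
def jointControl (g : Game nx nu ny) (x₀ : Ω → Vec nx) (w : ℕ → Ω → Vec nx)
    (s : Strategy nx nu ny) (t : ℕ) (e : (ℕ → Vec ny) × Ω) : Vec nu :=
  g.control s (x₀ e.2) (fun n => w n e.2) e.1 t

/-- The discounted cost as a random variable on the product of the belief and the noise space. -/
def jointCost (g : Game nx nu ny) (x₀ : Ω → Vec nx) (w : ℕ → Ω → Vec nx)
    (s : Strategy nx nu ny) (t : ℕ) (e : (ℕ → Vec ny) × Ω) : ℝ :=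
  g.discountedCost s (x₀ e.2) (fun n => w n e.2) e.1 t

theorem jointState_succ (s : Strategy nx nu ny) (t : ℕ) (e : (ℕ → Vec ny) × Ω) :
    jointState g x₀ w s (t + 1) e =
      g.A *ᵥ jointState g x₀ w s t e + g.B *ᵥ jointControl g x₀ w s t e + w t e.2 :=
  g.state_succ s _ _ _ t

variable [MeasurableSpace Ω] {P : Measure Ω}

theorem measurable_primitives (h : PlayerAssumption P ζ x₀ w) :
    Measurable fun e : (ℕ → Vec ny) × Ω => (x₀ e.2, (fun n => w n e.2), e.1) :=
  (h.measurable_x₀.comp measurable_snd).prodMk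
    ((measurable_pi_lambda _ fun n => (h.measurable_w n).comp measurable_snd).prodMk measurable_fst)

theorem measurable_jointState (h : PlayerAssumption P ζ x₀ w) (s : Strategy nx nu ny) (t : ℕ) :
    Measurable (jointState g x₀ w s t) :=
  (measurable_state_control s t).1.comp h.measurable_primitives

theorem measurable_jointControl (h : PlayerAssumption P ζ x₀ w) (s : Strategy nx nu ny) (t : ℕ) :
    Measurable (jointControl g x₀ w s t) :=
  (measurable_state_control s t).2.comp h.measurable_primitives

theorem measurable_jointCost (h : PlayerAssumption P ζ x₀ w) (s : Strategy nx nu ny) (t : ℕ) :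
    Measurable (jointCost g x₀ w s t) := by
  have h1 : Measurable fun e : (ℕ → Vec ny) × Ω =>
      (jointState g x₀ w s t e, jointControl g x₀ w s t e, e.1 t) :=
    (h.measurable_jointState s t).prodMk ((h.measurable_jointControl s t).prodMk
      ((measurable_pi_apply t).comp measurable_fst))
  have h2 : Measurable fun e : (ℕ → Vec ny) × Ω =>
      g.stageCost (jointState g x₀ w s t e) (jointControl g x₀ w s t e) (e.1 t) :=
    (continuous_stageCost (g := g)).measurable.comp h1
  exact h2.const_mul (g.β ^ t)

theorem integrable_sq_z (h : PlayerAssumption P ζ x₀ w) (t : ℕ) :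
    Integrable (fun z : ℕ → Vec ny => ‖z t‖ ^ 2) ζ := (h.memLp_z t).integrable_norm_pow two_ne_zero

theorem integral_sq_z (h : PlayerAssumption P ζ x₀ w) (t : ℕ) :
    ∫ z : ℕ → Vec ny, ‖z t‖ ^ 2 ∂ζ = ∫ z : ℕ → Vec ny, ‖z 0‖ ^ 2 ∂ζ :=
  (h.ident_z t).norm.sq.integral_eq

theorem form_S_nonneg (hR : g.R.PosDef) (hβ₀ : 0 ≤ g.β) {M : Matrix (Fin nx) (Fin nx) ℝ}
    (hM : M.PosSemidef) (s : Strategy nx nu ny) (t : ℕ) (h : Vec nu) :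
    0 ≤ ∫ e, (jointControl g x₀ w s t e -
      g.F M *ᵥ jointState g x₀ w s t e - h) ⬝ᵥ (g.S M *ᵥ (jointControl g x₀ w s t e -
        g.F M *ᵥ jointState g x₀ w s t e - h)) ∂(ζ.prod P) :=
  integral_nonneg fun _ => (posDef_S hR hβ₀ hM).posSemidef.form_nonneg _

variable [IsProbabilityMeasure P]

/-- The costs of every strategy are well defined. -/
theorem costDefined (h : PlayerAssumption P ζ x₀ w) (hQ : g.Q.PosDef) (hR : g.R.PosDef)
    (hβ₀ : 0 ≤ g.β) (hβ₁ : g.β < 1) (s : Strategy nx nu ny) : g.CostDefined P x₀ w ζ s := by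
  obtain ⟨a, D, ha, hD, hc⟩ := exists_le_stageCost hQ hR
  set m := ∫ z : ℕ → Vec ny, ‖z 0‖ ^ 2 ∂ζ
  -- By coercivity the negative part of the cost is at most `D ‖z_t‖²`, whatever the strategy; the
  -- expectation of this bound is constant in `t`, and discounting sums it.
  have hb : ∀ (z : ℕ → Vec ny) (ω : Ω) (t : ℕ),
      ENNReal.ofReal (-g.discountedCost s (x₀ ω) (fun t => w t ω) z t) ≤
        ENNReal.ofReal (g.β ^ t * D * ‖z t‖ ^ 2) := fun z ω t => by
    refine ENNReal.ofReal_le_ofReal ?_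
    rw [discountedCost, ← mul_neg, mul_assoc]
    refine mul_le_mul_of_nonneg_left ?_ (pow_nonneg hβ₀ t)
    have h1 := hc (g.state s (x₀ ω) (fun t => w t ω) z t)
      (g.control s (x₀ ω) (fun t => w t ω) z t) (z t)
    have h2 : 0 ≤ a * (‖g.state s (x₀ ω) (fun t => w t ω) z t‖ ^ 2 +
      ‖g.control s (x₀ ω) (fun t => w t ω) z t‖ ^ 2) := by positivity
    linarith
  have hmeas : ∀ t, Measurable fun z : ℕ → Vec ny => ENNReal.ofReal (g.β ^ t * D * ‖z t‖ ^ 2) :=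
    fun t => by fun_prop
  refine ne_top_of_le_ne_top ?_ (lintegral_mono fun z =>
    (lintegral_mono fun ω => ENNReal.tsum_le_tsum fun t => hb z ω t).trans_eq
      (by rw [lintegral_const, measure_univ, mul_one]))
  rw [lintegral_tsum fun t => (hmeas t).aemeasurable]
  have hint : ∀ t, ∫⁻ z : ℕ → Vec ny, ENNReal.ofReal (g.β ^ t * D * ‖z t‖ ^ 2) ∂ζ =
      ENNReal.ofReal (g.β ^ t * (D * m)) := fun t => by
    rw [← ofReal_integral_eq_lintegral_ofReal ((h.integrable_sq_z t).const_mul _)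
      (.of_forall fun z => by positivity), integral_const_mul, h.integral_sq_z, mul_assoc]
  simp only [hint]
  exact ((summable_geometric_of_lt_one hβ₀ hβ₁).mul_right _).tsum_ofReal_ne_top

/-- Used with `c` the identity and the negation, for positive and negative parts. -/
theorem lintegral_tsum_jointCost (h : PlayerAssumption P ζ x₀ w) (s : Strategy nx nu ny) {c : ℝ → ℝ}
    (hc : Measurable c) :
    ∫⁻ z, ∫⁻ ω, ∑' t, ENNReal.ofReal
      (c (g.discountedCost s (x₀ ω) (fun n => w n ω) z t)) ∂P ∂ζ =
    ∑' t, ∫⁻ e, ENNReal.ofReal (c (jointCost g x₀ w s t e)) ∂(ζ.prod P) := by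
  have hm : ∀ t, Measurable fun e : (ℕ → Vec ny) × Ω =>
      ENNReal.ofReal (c (jointCost g x₀ w s t e)) :=
    fun t => (hc.comp (h.measurable_jointCost s t)).ennreal_ofReal
  rw [← lintegral_tsum fun t => (hm t).aemeasurable,
    lintegral_prod _ (Measurable.tsum hm).aemeasurable]
  rfl

theorem tsum_neg_jointCost_ne_top (h : PlayerAssumption P ζ x₀ w) (hQ : g.Q.PosDef)
    (hR : g.R.PosDef) (hβ₀ : 0 ≤ g.β) (hβ₁ : g.β < 1) (s : Strategy nx nu ny) :
    ∑' t, ∫⁻ e, ENNReal.ofReal (-jointCost g x₀ w s t e) ∂(ζ.prod P) ≠ ⊤ := by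
  rw [← h.lintegral_tsum_jointCost s measurable_neg]
  exact h.costDefined hQ hR hβ₀ hβ₁ s

/-- The nested extended expectations collapse to the product measure: Tonelli applies to both parts
separately, and the finite negative total makes each difference legitimate, the inner one for almost
every `z`. -/
theorem believedCost_eq (h : PlayerAssumption P ζ x₀ w) (hQ : g.Q.PosDef) (hR : g.R.PosDef)
    (hβ₀ : 0 ≤ g.β) (hβ₁ : g.β < 1) (s : Strategy nx nu ny) :
    g.believedCost P x₀ w ζ s =
      ((∑' t, ∫⁻ e, ENNReal.ofReal (jointCost g x₀ w s t e) ∂(ζ.prod P) : ℝ≥0∞) : EReal) -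
      ((∑' t, ∫⁻ e, ENNReal.ofReal (-jointCost g x₀ w s t e) ∂(ζ.prod P) : ℝ≥0∞) : EReal) := by
  have hm := fun t => h.measurable_jointCost (g := g) s t
  have hp : Measurable fun e : (ℕ → Vec ny) × Ω =>
      ∑' t, ENNReal.ofReal (jointCost g x₀ w s t e) :=
    Measurable.tsum fun t => (hm t).ennreal_ofReal
  have hn : Measurable fun e : (ℕ → Vec ny) × Ω =>
      ∑' t, ENNReal.ofReal (-jointCost g x₀ w s t e) :=
    Measurable.tsum fun t => (hm t).neg.ennreal_ofReal
  have hfin : ∫⁻ z, ∫⁻ ω, ∑' t, ENNReal.ofReal (-jointCost g x₀ w s t (z, ω)) ∂P ∂ζ ≠ ⊤ :=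
    h.costDefined hQ hR hβ₀ hβ₁ s
  have hcost : g.cost P x₀ w s =ᵐ[ζ] fun z =>
      ((∫⁻ ω, ∑' t, ENNReal.ofReal (jointCost g x₀ w s t (z, ω)) ∂P : ℝ≥0∞) : EReal) -
      ((∫⁻ ω, ∑' t, ENNReal.ofReal (-jointCost g x₀ w s t (z, ω)) ∂P : ℝ≥0∞) : EReal) := by
    filter_upwards [ae_lt_top hn.lintegral_prod_right' hfin] with z hz
    have hpz : Measurable fun ω => ∑' t, ENNReal.ofReal (jointCost g x₀ w s t (z, ω)) :=
      hp.comp measurable_prodMk_left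
    have hnz : Measurable fun ω => ∑' t, ENNReal.ofReal (-jointCost g x₀ w s t (z, ω)) :=
      hn.comp measurable_prodMk_left
    rw [← extExp_sub hpz hnz hz.ne]
    rfl
  have hp' : Measurable fun z => ∫⁻ ω, ∑' t, ENNReal.ofReal (jointCost g x₀ w s t (z, ω)) ∂P :=
    hp.lintegral_prod_right'
  have hn' : Measurable fun z => ∫⁻ ω, ∑' t, ENNReal.ofReal (-jointCost g x₀ w s t (z, ω)) ∂P :=
    hn.lintegral_prod_right'
  have h1 := h.lintegral_tsum_jointCost (g := g) s measurable_id
  have h2 := h.lintegral_tsum_jointCost (g := g) s measurable_neg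
  simp only [id_eq] at h1
  rw [believedCost, extExp_congr hcost, extExp_sub hp' hn' hfin, ← h1, ← h2]
  rfl

theorem memLp_joint_z (h : PlayerAssumption P ζ x₀ w) (t : ℕ) :
    MemLp (fun e : (ℕ → Vec ny) × Ω => e.1 t) 2 (ζ.prod P) :=
  (h.memLp_z t).comp_measurePreserving measurePreserving_fst

variable [IsProbabilityMeasure ζ]

/-- State and control at time `t` use only `x₀`, the earlier disturbances and the environment. The
first two are independent of `w t` by assumption, the last by the product structure. -/
theorem indepFun_w (h : PlayerAssumption P ζ x₀ w) (s : Strategy nx nu ny) (t : ℕ) :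
    IndepFun (fun e => (jointState g x₀ w s t e, jointControl g x₀ w s t e))
      (fun e : (ℕ → Vec ny) × Ω => w t e.2) (ζ.prod P) := by
  have h1 := indepFun_prod_snd (μ := ζ) (h.indep_w t)
    (h.measurable_x₀.prodMk (measurable_pi_lambda _ fun k => h.measurable_w k)) (h.measurable_w t)
  let ψ : (ℕ → Vec ny) × (Vec nx × (Fin t → Vec nx)) → Vec nx × Vec nu := fun q =>
    (g.state s q.2.1 (extendZero t q.2.2) q.1 t, g.control s q.2.1 (extendZero t q.2.2) q.1 t)
  have hψ : Measurable ψ := by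
    have h2 : Measurable fun q : (ℕ → Vec ny) × (Vec nx × (Fin t → Vec nx)) =>
        (q.2.1, extendZero t q.2.2, q.1) :=
      (measurable_fst.comp measurable_snd).prodMk (((measurable_extendZero t).comp
        (measurable_snd.comp measurable_snd)).prodMk measurable_fst)
    exact ((measurable_state_control s t).1.comp h2).prodMk
      ((measurable_state_control s t).2.comp h2)
  have h3 := h1.comp hψ measurable_id
  refine h3.congr (.of_forall fun e => ?_) (.of_forall fun e => rfl)
  have h4 := state_control_congr (g := g) s (x₀ e.2) (z := e.1) (z' := e.1) t
    (fun k hk => extendZero_apply t (fun n => w n e.2) hk) fun k hk => rfl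
  exact Prod.ext h4.1 h4.2

/-- Strategies see only `z_0, …, z_{t-1}` at time `t`, which are independent of `z_t` under the
belief; the noise space is the other factor of the product. -/
theorem indepFun_z (h : PlayerAssumption P ζ x₀ w) (s : Strategy nx nu ny) (t : ℕ) :
    IndepFun (fun e => (jointState g x₀ w s t e, jointControl g x₀ w s t e))
      (fun e : (ℕ → Vec ny) × Ω => e.1 t) (ζ.prod P) := by
  have h1 := indepFun_prod_fst (ν := P) (h.indep_z t)
    (measurable_pi_lambda _ fun k => measurable_pi_apply _) (measurable_pi_apply t)
  let ψ : (Fin t → Vec ny) × Ω → Vec nx × Vec nu := fun q =>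
    (g.state s (x₀ q.2) (fun n => w n q.2) (extendZero t q.1) t,
      g.control s (x₀ q.2) (fun n => w n q.2) (extendZero t q.1) t)
  have hψ : Measurable ψ := by
    have h2 : Measurable fun q : (Fin t → Vec ny) × Ω =>
        (x₀ q.2, (fun n => w n q.2), extendZero t q.1) :=
      (h.measurable_x₀.comp measurable_snd).prodMk
        ((measurable_pi_lambda _ fun n => (h.measurable_w n).comp measurable_snd).prodMk
          ((measurable_extendZero t).comp measurable_fst))
    exact ((measurable_state_control s t).1.comp h2).prodMk
      ((measurable_state_control s t).2.comp h2)
  have h3 := h1.comp hψ measurable_id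
  refine h3.congr (.of_forall fun e => ?_) (.of_forall fun e => rfl)
  have h4 := state_control_congr (g := g) s (x₀ e.2) (w := fun n => w n e.2)
    (w' := fun n => w n e.2) t (fun k hk => rfl) fun k hk => extendZero_apply t e.1 hk
  exact Prod.ext h4.1 h4.2

theorem memLp_joint_w (h : PlayerAssumption P ζ x₀ w) (t : ℕ) :
    MemLp (fun e : (ℕ → Vec ny) × Ω => w t e.2) 2 (ζ.prod P) :=
  (h.memLp_w t).comp_measurePreserving measurePreserving_snd

theorem integral_joint_z (h : PlayerAssumption P ζ x₀ w) (t : ℕ) :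
    ∫ e : (ℕ → Vec ny) × Ω, e.1 t ∂(ζ.prod P) = ∫ z : ℕ → Vec ny, z 0 ∂ζ := by
  rw [integral_fun_fst (fun z : ℕ → Vec ny => z t), probReal_univ, one_smul]
  exact (h.ident_z t).integral_eq

theorem integral_joint_w (h : PlayerAssumption P ζ x₀ w) (t : ℕ) :
    ∫ e : (ℕ → Vec ny) × Ω, w t e.2 ∂(ζ.prod P) = ∫ ω, w 0 ω ∂P := by
  rw [integral_fun_snd, probReal_univ, one_smul]
  exact (h.ident_w t).integral_eq

theorem integral_joint_form_w (h : PlayerAssumption P ζ x₀ w) (M : Matrix (Fin nx) (Fin nx) ℝ)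
    (t : ℕ) : ∫ e : (ℕ → Vec ny) × Ω, w t e.2 ⬝ᵥ (M *ᵥ w t e.2) ∂(ζ.prod P) =
      ∫ ω, w 0 ω ⬝ᵥ (M *ᵥ w 0 ω) ∂P := by
  rw [integral_fun_snd fun ω => w t ω ⬝ᵥ (M *ᵥ w t ω), probReal_univ, one_smul]
  have hm : Measurable fun x : Vec nx => x ⬝ᵥ (M *ᵥ x) := by
    have : Continuous fun x : Vec nx => x ⬝ᵥ (M *ᵥ x) := by fun_prop
    exact this.measurable
  exact ((h.ident_w t).comp hm).integral_eq

theorem memLp_jointState_succ (h : PlayerAssumption P ζ x₀ w) {s : Strategy nx nu ny} {t : ℕ}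
    (hX : MemLp (jointState g x₀ w s t) 2 (ζ.prod P))
    (hU : MemLp (jointControl g x₀ w s t) 2 (ζ.prod P)) :
    MemLp (jointState g x₀ w s (t + 1)) 2 (ζ.prod P) := by
  have : jointState g x₀ w s (t + 1) = fun e => g.A *ᵥ jointState g x₀ w s t e +
      g.B *ᵥ jointControl g x₀ w s t e + w t e.2 := funext fun e => jointState_succ s t e
  rw [this]
  exact ((memLp_mulVec g.A hX).add (memLp_mulVec g.B hU)).add (h.memLp_joint_w t)

/-- The equations which determine the value function and the affine feedback. -/
structure IsOptimalityData (g : Game nx nu ny) (P : Measure Ω) (ζ : Measure (ℕ → Vec ny))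
    (w : ℕ → Ω → Vec nx) (M : Matrix (Fin nx) (Fin nx) ℝ) (p : Vec nx) (h : Vec nu) (r : ℝ) :
    Prop where
  riccati : g.IsRiccatiSolution M
  control_eq : g.S M *ᵥ h = -(g.Kᵀ *ᵥ (∫ z : ℕ → Vec ny, z 0 ∂ζ) +
    g.β • (g.Bᵀ *ᵥ (M *ᵥ (∫ ω, w 0 ω ∂P) + p)))
  linear_eq : p = (g.F M)ᵀ *ᵥ (g.Kᵀ *ᵥ (∫ z : ℕ → Vec ny, z 0 ∂ζ)) +
    g.Lᵀ *ᵥ (∫ z : ℕ → Vec ny, z 0 ∂ζ) + g.Γ M *ᵥ (M *ᵥ (∫ ω, w 0 ω ∂P) + p)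
  constant_eq : r = g.β * (∫ ω, w 0 ω ⬝ᵥ (M *ᵥ w 0 ω) ∂P + 2 * (p ⬝ᵥ ∫ ω, w 0 ω ∂P) + r) -
    h ⬝ᵥ (g.S M *ᵥ h)

variable {M : Matrix (Fin nx) (Fin nx) ℝ} {p : Vec nx} {h : Vec nu} {r : ℝ}

/-- The telescoping identity: a difference of discounted values plus a nonnegative loss that
vanishes for the affine feedback. -/
theorem integral_jointCost (hp : PlayerAssumption P ζ x₀ w) (hR : g.R.PosDef) (hβ₀ : 0 ≤ g.β)
    (hd : IsOptimalityData g P ζ w M p h r) {s : Strategy nx nu ny} {t : ℕ}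
    (hX : MemLp (jointState g x₀ w s t) 2 (ζ.prod P))
    (hU : MemLp (jointControl g x₀ w s t) 2 (ζ.prod P)) :
    ∫ e, jointCost g x₀ w s t e ∂(ζ.prod P) =
      g.β ^ t * ∫ e, valueFn M p r (jointState g x₀ w s t e) ∂(ζ.prod P) -
      g.β ^ (t + 1) * ∫ e, valueFn M p r (jointState g x₀ w s (t + 1) e) ∂(ζ.prod P) +
      g.β ^ t * ∫ e, (jointControl g x₀ w s t e - g.F M *ᵥ jointState g x₀ w s t e - h) ⬝ᵥ
        (g.S M *ᵥ (jointControl g x₀ w s t e - g.F M *ᵥ jointState g x₀ w s t e - h))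
          ∂(ζ.prod P) := by
  have h1 := hd.riccati.integral_bellman (μ := ζ.prod P) (Z := fun e => e.1 t)
    (W := fun e => w t e.2) (p := p) (h := h) (r := r) hR hβ₀
    (by rw [hp.integral_joint_z, hp.integral_joint_w]; exact hd.control_eq)
    (by rw [hp.integral_joint_z, hp.integral_joint_w]; exact hd.linear_eq)
    (by rw [hp.integral_joint_form_w, hp.integral_joint_w]; exact hd.constant_eq)
    hX hU (hp.memLp_joint_z t) (hp.memLp_joint_w t) (hp.indepFun_z s t) (hp.indepFun_w s t)
  simp only [← jointState_succ] at h1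
  have h2 : ∫ e, jointCost g x₀ w s t e ∂(ζ.prod P) = g.β ^ t * ∫ e, g.stageCost
      (jointState g x₀ w s t e) (jointControl g x₀ w s t e) (e.1 t) ∂(ζ.prod P) :=
    integral_const_mul _ _
  rw [h2, eq_sub_of_add_eq h1]
  ring

/-- The expected value at time zero is a lower bound of the costs of all strategies. -/
theorem le_believedCost (hp : PlayerAssumption P ζ x₀ w) (hQ : g.Q.PosDef) (hR : g.R.PosDef)
    (hβ₀ : 0 ≤ g.β) (hβ₁ : g.β < 1) (hd : IsOptimalityData g P ζ w M p h r)
    (s : Strategy nx nu ny) :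
    ((∫ e : (ℕ → Vec ny) × Ω, valueFn M p r (x₀ e.2) ∂(ζ.prod P) : ℝ) : EReal) ≤
      g.believedCost P x₀ w ζ s := by
  have hneg := hp.tsum_neg_jointCost_ne_top hQ hR hβ₀ hβ₁ s
  rw [hp.believedCost_eq hQ hR hβ₀ hβ₁ s]
  -- An infinite positive part makes the cost `⊤` and the bound trivial. Otherwise the costs are
  -- integrable, and second moments of state and control can be extracted from them.
  by_cases hpos : ∑' t, ∫⁻ e, ENNReal.ofReal (jointCost g x₀ w s t e) ∂(ζ.prod P) = ⊤
  · rw [hpos]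
    lift ∑' t, ∫⁻ e, ENNReal.ofReal (-jointCost g x₀ w s t e) ∂(ζ.prod P) to NNReal
      using hneg with N
    have : ((⊤ : ℝ≥0∞) : EReal) - ((N : ℝ≥0∞) : EReal) = ⊤ := by simp
    rw [this]
    exact le_top
  obtain ⟨hint, hsum⟩ := hasSum_integral_of_pos_neg (hp.measurable_jointCost s) hpos hneg
  obtain ⟨a, D, ha, hD, hc⟩ := exists_le_stageCost hQ hR
  set μ := ζ.prod P
  set m := ∫ z : ℕ → Vec ny, ‖z 0‖ ^ 2 ∂ζ
  have hzint : ∀ t, Integrable (fun e : (ℕ → Vec ny) × Ω => ‖e.1 t‖ ^ 2) μ := fun t =>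
    (hp.memLp_joint_z t).integrable_norm_pow two_ne_zero
  have hzm : ∀ t, ∫ e : (ℕ → Vec ny) × Ω, ‖e.1 t‖ ^ 2 ∂μ = m := fun t => by
    rw [integral_fun_fst (fun z : ℕ → Vec ny => ‖z t‖ ^ 2), probReal_univ, one_smul,
      hp.integral_sq_z]
  have hle : ∀ t e, g.β ^ t * (a * (‖jointState g x₀ w s t e‖ ^ 2 +
      ‖jointControl g x₀ w s t e‖ ^ 2)) ≤
      jointCost g x₀ w s t e + g.β ^ t * D * ‖e.1 t‖ ^ 2 := fun t e => by
    have h1 := mul_le_mul_of_nonneg_left (hc (jointState g x₀ w s t e)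
      (jointControl g x₀ w s t e) (e.1 t)) (pow_nonneg hβ₀ t)
    have h2 : jointCost g x₀ w s t e = g.β ^ t * g.stageCost (jointState g x₀ w s t e)
      (jointControl g x₀ w s t e) (e.1 t) := rfl
    rw [h2]
    linarith
  have hmaj : ∀ t, Integrable (fun e : (ℕ → Vec ny) × Ω =>
      jointCost g x₀ w s t e + g.β ^ t * D * ‖e.1 t‖ ^ 2) μ := fun t =>
    (hint t).add ((hzint t).const_mul _)
  -- The case `β ^ t = 0` occurs when `β = 0` and `t ≥ 1`; the cost then carries no information
  -- about the state, which need not be square integrable.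
  have hsq : ∀ t, g.β ^ t ≠ 0 → Integrable (fun e => ‖jointState g x₀ w s t e‖ ^ 2 +
      ‖jointControl g x₀ w s t e‖ ^ 2) μ := fun t ht => by
    have hpt : 0 < g.β ^ t := lt_of_le_of_ne (pow_nonneg hβ₀ t) ht.symm
    have hm := ((hp.measurable_jointState (g := g) s t).norm.pow_const 2).add
      ((hp.measurable_jointControl (g := g) s t).norm.pow_const 2)
    refine ((hmaj t).const_mul (g.β ^ t * a)⁻¹).mono' hm.aestronglyMeasurable
      (.of_forall fun e => ?_)
    rw [Real.norm_of_nonneg (by positivity), le_inv_mul_iff₀ (by positivity)]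
    refine le_trans (le_of_eq ?_) (hle t e)
    ring
  have hX : ∀ t, g.β ^ t ≠ 0 → MemLp (jointState g x₀ w s t) 2 μ := fun t ht => by
    refine (memLp_two_iff_integrable_sq_norm
      (hp.measurable_jointState s t).aestronglyMeasurable).2 ?_
    refine (hsq t ht).mono' ((hp.measurable_jointState s t).norm.pow_const 2).aestronglyMeasurable
      (.of_forall fun e => ?_)
    rw [Real.norm_of_nonneg (by positivity)]
    exact le_add_of_nonneg_right (by positivity)
  have hU : ∀ t, g.β ^ t ≠ 0 → MemLp (jointControl g x₀ w s t) 2 μ := fun t ht => by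
    refine (memLp_two_iff_integrable_sq_norm
      (hp.measurable_jointControl s t).aestronglyMeasurable).2 ?_
    refine (hsq t ht).mono' ((hp.measurable_jointControl s t).norm.pow_const 2).aestronglyMeasurable
      (.of_forall fun e => ?_)
    rw [Real.norm_of_nonneg (by positivity)]
    exact le_add_of_nonneg_left (by positivity)
  set v : ℕ → ℝ := fun t => ∫ e, valueFn M p r (jointState g x₀ w s t e) ∂μ with hv
  have hstep : ∀ t, g.β ^ t * v t - g.β ^ (t + 1) * v (t + 1) ≤
      ∫ e, jointCost g x₀ w s t e ∂μ := fun t => by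
    -- Here `β ^ (t + 1) = 0` as well, so both sides vanish whatever the values of `v`.
    by_cases ht : g.β ^ t = 0
    · have h0 : ∀ e, jointCost g x₀ w s t e = 0 := fun e => by
        rw [jointCost, discountedCost, ht, zero_mul]
      simp only [pow_succ, ht, h0, zero_mul, integral_zero, sub_zero, le_refl]
    · rw [hp.integral_jointCost hR hβ₀ hd (hX t ht) (hU t ht)]
      exact le_add_of_nonneg_right
        (mul_nonneg (pow_nonneg hβ₀ t) (form_S_nonneg hR hβ₀ hd.riccati.1 s t h))
  have hv0 : v 0 = ∫ e : (ℕ → Vec ny) × Ω, valueFn M p r (x₀ e.2) ∂μ := by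
    simp only [hv, jointState, g.state_zero]
  have htel : ∀ T, v 0 - g.β ^ T * v T ≤
      ∑ t ∈ Finset.range T, ∫ e, jointCost g x₀ w s t e ∂μ := fun T => by
    have h1 := Finset.sum_le_sum fun t (_ : t ∈ Finset.range T) => hstep t
    rw [Finset.sum_range_sub' fun t => g.β ^ t * v t] at h1
    simpa using h1
  obtain ⟨C, hC0, hC⟩ := exists_valueFn_le M p r
  -- In place of a transversality condition: `V` is at most quadratic and the stage cost is
  -- coercive, so the tail is controlled by the expected cost at time `T`, a term of a convergent
  -- series.
  have hvle : ∀ T, g.β ^ T * v T ≤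
      C * (a⁻¹ * (∫ e, jointCost g x₀ w s T e ∂μ + g.β ^ T * (D * m)) + g.β ^ T) := fun T => by
    have hb : g.β ^ T * ∫ e, ‖jointState g x₀ w s T e‖ ^ 2 ∂μ ≤
        a⁻¹ * (∫ e, jointCost g x₀ w s T e ∂μ + g.β ^ T * (D * m)) := by
      have h1 : ∫ e, (jointCost g x₀ w s T e + g.β ^ T * D * ‖e.1 T‖ ^ 2) ∂μ =
          ∫ e, jointCost g x₀ w s T e ∂μ + g.β ^ T * (D * m) := by
        rw [integral_add (hint T) ((hzint T).const_mul _), integral_const_mul, hzm, mul_assoc]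
      rw [← h1, ← integral_const_mul, ← integral_const_mul]
      -- No integrability of the smaller function is needed, so `hb` also covers `β ^ T = 0`, where
      -- it says that the bracket is nonnegative.
      refine integral_mono_of_nonneg (.of_forall fun e => ?_) ((hmaj T).const_mul _)
        (.of_forall fun e => ?_)
      · exact mul_nonneg (pow_nonneg hβ₀ T) (by positivity)
      · change _ ≤ a⁻¹ * _
        rw [le_inv_mul_iff₀ ha]
        refine le_trans ?_ (hle T e)
        have h2 : 0 ≤ g.β ^ T * (a * ‖jointControl g x₀ w s T e‖ ^ 2) :=
          mul_nonneg (pow_nonneg hβ₀ T) (by positivity)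
        change a * (g.β ^ T * ‖jointState g x₀ w s T e‖ ^ 2) ≤ _
        linarith
    by_cases hT : g.β ^ T = 0
    · rw [hT] at hb ⊢
      rw [zero_mul] at hb
      rw [zero_mul]
      exact mul_nonneg hC0 (by linarith)
    · have hXT : Integrable (fun e => ‖jointState g x₀ w s T e‖ ^ 2) μ :=
        (hX T hT).integrable_norm_pow two_ne_zero
      have h1 : v T ≤ C * (∫ e, ‖jointState g x₀ w s T e‖ ^ 2 ∂μ + 1) := by
        have h2 : ∫ e, C * (‖jointState g x₀ w s T e‖ ^ 2 + 1) ∂μ =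
            C * (∫ e, ‖jointState g x₀ w s T e‖ ^ 2 ∂μ + 1) := by
          rw [integral_const_mul, integral_add hXT (integrable_const _), integral_const,
            probReal_univ, one_smul]
        rw [← h2]
        exact integral_mono (integrable_valueFn M p r (hX T hT))
          ((hXT.add (integrable_const _)).const_mul C) fun e => hC _
      calc g.β ^ T * v T ≤ g.β ^ T * (C * (∫ e, ‖jointState g x₀ w s T e‖ ^ 2 ∂μ + 1)) :=
            mul_le_mul_of_nonneg_left h1 (pow_nonneg hβ₀ T)
        _ = C * (g.β ^ T * ∫ e, ‖jointState g x₀ w s T e‖ ^ 2 ∂μ + g.β ^ T) := by ring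
        _ ≤ _ := by gcongr
  have hβT : Tendsto (fun T : ℕ => g.β ^ T) atTop (nhds 0) :=
    tendsto_pow_atTop_nhds_zero_of_lt_one hβ₀ hβ₁
  have hlim : Tendsto (fun T => C * (a⁻¹ * (∫ e, jointCost g x₀ w s T e ∂μ +
      g.β ^ T * (D * m)) + g.β ^ T)) atTop (nhds 0) := by
    simpa using (((hsum.summable.tendsto_atTop_zero.add (hβT.mul_const (D * m))).const_mul
      a⁻¹).add hβT).const_mul C
  have hfinal := le_of_tendsto_of_tendsto' (hlim.const_sub (v 0)) hsum.tendsto_sum_nat fun T =>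
    (sub_le_sub_left (hvle T) (v 0)).trans (htel T)
  rw [sub_zero, hv0] at hfinal
  rw [← EReal.coe_ennreal_toReal hpos, ← EReal.coe_ennreal_toReal hneg, ← EReal.coe_sub,
    EReal.coe_le_coe_iff]
  exact hfinal

/-- The affine feedback attains the expected value at time zero. -/
theorem believedCost_affineStrategy_le (hp : PlayerAssumption P ζ x₀ w) (hQ : g.Q.PosDef)
    (hR : g.R.PosDef) (hβ₀ : 0 ≤ g.β) (hβ₁ : g.β < 1)
    (hd : IsOptimalityData g P ζ w M p h r) :
    g.believedCost P x₀ w ζ (affineStrategy ny (g.F M) h) ≤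
      ((∫ e : (ℕ → Vec ny) × Ω, valueFn M p r (x₀ e.2) ∂(ζ.prod P) : ℝ) : EReal) := by
  set s : Strategy nx nu ny := affineStrategy ny (g.F M) h with hs
  have hneg := hp.tsum_neg_jointCost_ne_top hQ hR hβ₀ hβ₁ s
  rw [hp.believedCost_eq hQ hR hβ₀ hβ₁ s]
  set μ := ζ.prod P
  have hctrl : ∀ t, jointControl g x₀ w s t = fun e => g.F M *ᵥ jointState g x₀ w s t e + h :=
    fun t => funext fun e => control_affineStrategy g (g.F M) h _ _ _ t
  have hU : ∀ t, MemLp (jointState g x₀ w s t) 2 μ → MemLp (jointControl g x₀ w s t) 2 μ :=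
    fun t hX => by
      rw [hctrl]
      exact (memLp_mulVec _ hX).add (memLp_const h)
  have hX : ∀ t, MemLp (jointState g x₀ w s t) 2 μ := fun t => by
    induction t with
    | zero =>
      have : jointState g x₀ w s 0 = fun e => x₀ e.2 := funext fun e => g.state_zero _ _ _ _
      rw [this]
      exact hp.memLp_x₀.comp_measurePreserving measurePreserving_snd
    | succ t ih => exact hp.memLp_jointState_succ ih (hU t ih)
  have hint : ∀ t, Integrable (jointCost g x₀ w s t) μ := fun t =>
    (integrable_stageCost (hX t) (hU t (hX t)) (hp.memLp_joint_z t)).const_mul (g.β ^ t)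
  set v : ℕ → ℝ := fun t => ∫ e, valueFn M p r (jointState g x₀ w s t e) ∂μ with hv
  have hstep : ∀ t, ∫ e, jointCost g x₀ w s t e ∂μ =
      g.β ^ t * v t - g.β ^ (t + 1) * v (t + 1) := fun t => by
    rw [hp.integral_jointCost hR hβ₀ hd (hX t) (hU t (hX t))]
    simp [hctrl, hv, μ]
  have hv0 : v 0 = ∫ e : (ℕ → Vec ny) × Ω, valueFn M p r (x₀ e.2) ∂μ := by
    simp only [hv, jointState, g.state_zero]
  have htel : ∀ T, ∑ t ∈ Finset.range T, ∫ e, jointCost g x₀ w s t e ∂μ =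
      v 0 - g.β ^ T * v T := fun T => by
    simp only [hstep]
    rw [Finset.sum_range_sub' fun t => g.β ^ t * v t]
    simp
  obtain ⟨a, ha, hM⟩ := hd.riccati.exists_le_form hQ hR hβ₀
  obtain ⟨C, hC0, hC⟩ := exists_le_valueFn ha hM p r
  -- `M` is coercive, so `V` is bounded below uniformly. Only this side of the tail is needed for
  -- the upper bound on the cost.
  have hvC : ∀ T, -C ≤ v T := fun T => by
    have h1 : ∫ _ : (ℕ → Vec ny) × Ω, -C ∂μ ≤ v T :=
      integral_mono (integrable_const _) (integrable_valueFn M p r (hX T)) fun e => hC _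
    rwa [integral_const, probReal_univ, one_smul] at h1
  have hbd : ∀ T, ∑ t ∈ Finset.range T, ∫ e, jointCost g x₀ w s t e ∂μ ≤
      v 0 + g.β ^ T * C := fun T => by
    rw [htel]
    have := mul_le_mul_of_nonneg_left (hvC T) (pow_nonneg hβ₀ T)
    linarith
  have hpos : ∑' t, ∫⁻ e, ENNReal.ofReal (jointCost g x₀ w s t e) ∂μ ≠ ⊤ :=
    tsum_lintegral_pos_ne_top hint hneg (c := v 0 + C) fun T => (hbd T).trans (by
      have := mul_le_mul_of_nonneg_right (pow_le_one₀ hβ₀ hβ₁.le (n := T)) hC0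
      linarith)
  have hsum := (hasSum_integral_of_pos_neg (hp.measurable_jointCost s) hpos hneg).2
  have hlim : Tendsto (fun T : ℕ => v 0 + g.β ^ T * C) atTop (nhds (v 0)) := by
    simpa using ((tendsto_pow_atTop_nhds_zero_of_lt_one hβ₀ hβ₁).mul_const C).const_add (v 0)
  have hfinal := le_of_tendsto_of_tendsto' hsum.tendsto_sum_nat hlim hbd
  rw [hv0] at hfinal
  rw [← EReal.coe_ennreal_toReal hpos, ← EReal.coe_ennreal_toReal hneg, ← EReal.coe_sub,
    EReal.coe_le_coe_iff]
  exact hfinal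

theorem believedCost_affineStrategy_le_believedCost (hp : PlayerAssumption P ζ x₀ w)
    (hQ : g.Q.PosDef) (hR : g.R.PosDef) (hβ₀ : 0 ≤ g.β) (hβ₁ : g.β < 1)
    (hM : g.IsRiccatiSolution M) (s : Strategy nx nu ny) :
    g.believedCost P x₀ w ζ (affineStrategy ny (g.F M)
      (g.G M *ᵥ (∫ z : ℕ → Vec ny, z 0 ∂ζ) + g.H M (∫ ω, w 0 ω ∂P))) ≤
        g.believedCost P x₀ w ζ s := by
  obtain ⟨p, hh, hlin⟩ := hM.exists_linear_part hQ hR hβ₀ hβ₁ (∫ z : ℕ → Vec ny, z 0 ∂ζ)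
    (∫ ω, w 0 ω ∂P)
  set h := g.G M *ᵥ (∫ z : ℕ → Vec ny, z 0 ∂ζ) + g.H M (∫ ω, w 0 ω ∂P)
  have hβ : 1 - g.β ≠ 0 := by linarith
  -- The last argument solves the scalar equation for `r`, which is possible since `β ≠ 1`.
  have hd : IsOptimalityData g P ζ w M p h ((g.β * (∫ ω, w 0 ω ⬝ᵥ (M *ᵥ w 0 ω) ∂P +
      2 * (p ⬝ᵥ ∫ ω, w 0 ω ∂P)) - h ⬝ᵥ (g.S M *ᵥ h)) / (1 - g.β)) :=
    ⟨hM, hh, hlin, by field_simp; ring⟩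
  exact (hp.believedCost_affineStrategy_le hQ hR hβ₀ hβ₁ hd).trans
    (hp.le_believedCost hQ hR hβ₀ hβ₁ hd s)

end PlayerAssumption

/-! ### From the primitives to the single-player setting. -/

namespace PrimitiveAssumption

variable {Ω : Type*} [MeasurableSpace Ω] {P : Measure Ω} {nx nu ny : ℕ}
  {x₀ : ℕ → Ω → Vec nx} {w : ℕ → ℕ → Ω → Vec nx} {ξ : ℕ → Ω → Vec ny}

/-- The noises before time `t`, shifted by a constant, are independent of the noise at time `t`. -/
theorem indepFun_ξ_before (hp : PrimitiveAssumption P x₀ w ξ) (c : Vec ny) (t : ℕ) :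
    IndepFun (fun ω (k : Fin t) => c + ξ k ω) (fun ω => c + ξ t ω) P := by
  have hξ : ∀ {S : Set (ℕ ⊕ (ℕ × ℕ) ⊕ ℕ)} {k : ℕ}, Sum.inr (Sum.inr k) ∈ S →
      Measurable[sigmaOf x₀ w ξ S] fun ω => c + ξ k ω := fun {S k} hk =>
    Measurable.const_add (measurable_sigmaOf hk (comap_measurable (ξ k))) c
  refine hp.indepFun_of_disjoint (S := {k | ∃ n < t, k = Sum.inr (Sum.inr n)})
    (T := {Sum.inr (Sum.inr t)}) ?_
    (@measurable_pi_lambda _ _ _ (_) _ _ fun k => hξ ⟨k, k.2, rfl⟩) (hξ rfl)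
  rw [Set.disjoint_left]
  rintro _ ⟨n, hn, rfl⟩ h
  simp only [Set.mem_singleton_iff, Sum.inr.injEq] at h
  omega

variable [IsProbabilityMeasure P]

/-- The belief is the law of the noises shifted by a constant, so it inherits identical
distribution, independence of the past and second moments from `ξ`. -/
theorem playerAssumption (hp : PrimitiveAssumption P x₀ w ξ) (c : Vec ny) (i : ℕ) :
    PlayerAssumption P (P.map fun ω t => c + ξ t ω) (x₀ i) (w i) where
  measurable_x₀ := hp.measurable_x₀ i
  measurable_w := hp.measurable_w i
  memLp_x₀ := hp.memLp_x₀ i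
  memLp_w := hp.memLp_w i
  ident_w t := (hp.ident_w i t).trans (hp.ident_w i 0).symm
  indep_w := hp.indepFun_before i
  memLp_z t := by
    have hm : Measurable fun ω t => c + ξ t ω :=
      measurable_pi_lambda _ fun t => (hp.measurable_ξ t).const_add c
    exact (memLp_map_measure_iff (measurable_pi_apply t).aestronglyMeasurable hm.aemeasurable).2
      ((memLp_const c).add (hp.memLp_ξ t))
  ident_z t := by
    have hm : Measurable fun ω t => c + ξ t ω :=
      measurable_pi_lambda _ fun t => (hp.measurable_ξ t).const_add c
    refine ⟨(measurable_pi_apply t).aemeasurable, (measurable_pi_apply 0).aemeasurable, ?_⟩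
    rw [Measure.map_map (measurable_pi_apply t) hm, Measure.map_map (measurable_pi_apply 0) hm]
    exact ((hp.ident_ξ t).comp (measurable_const_add c)).map_eq
  indep_z t := by
    have hm : Measurable fun ω t => c + ξ t ω :=
      measurable_pi_lambda _ fun t => (hp.measurable_ξ t).const_add c
    have h := hp.indepFun_ξ_before c t
    rw [indepFun_iff_measure_inter_preimage_eq_mul] at h ⊢
    intro A B hA hB
    have hA' : MeasurableSet ((fun (z : ℕ → Vec ny) (k : Fin t) => z k) ⁻¹' A) :=
      (measurable_pi_lambda _ fun k : Fin t => measurable_pi_apply (k : ℕ)) hA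
    have hB' : MeasurableSet ((fun z : ℕ → Vec ny => z t) ⁻¹' B) := measurable_pi_apply t hB
    rw [Measure.map_apply hm (hA'.inter hB'), Measure.map_apply hm hA', Measure.map_apply hm hB']
    exact h A B hA hB

end PrimitiveAssumption

end LQ

/-! ### The equilibrium. -/

theorem theorem3 {Ω : Type*} [MeasurableSpace Ω] (P : Measure Ω) [IsProbabilityMeasure P]
    {nx nu ny : ℕ} (g : LQ.Game nx nu ny)
    (hQ : g.Q.PosDef) (hR : g.R.PosDef) (hβ₀ : 0 ≤ g.β) (hβ₁ : g.β < 1)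
    (hAB : LQ.IsStabilizable g.A g.B)
    (x₀ : ℕ → Ω → LQ.Vec nx) (w : ℕ → ℕ → Ω → LQ.Vec nx) (ξ : ℕ → Ω → LQ.Vec ny)
    (hprim : LQ.PrimitiveAssumption P x₀ w ξ) :
    -- the constants `F`, `G`, `H` are well defined
    (∃! M, g.IsRiccatiSolution M) ∧
    ∀ M, g.IsRiccatiSolution M →
      Summable (g.Gseq M) ∧ IsUnit (1 - g.Γ M) ∧
      ∀ (F : Matrix (Fin nu) (Fin nx) ℝ) (G : Matrix (Fin nu) (Fin ny) ℝ) (H : LQ.Vec nu),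
        F = g.F M → G = g.G M → H = g.H M (∫ ω, w 0 0 ω ∂P) →
        ∀ (yhat : LQ.Vec ny) (xhat : LQ.Vec nx),
          yhat = (g.E1 * F + g.E2) *ᵥ xhat + (g.E1 * G) *ᵥ yhat + g.E1 *ᵥ H + ∫ ω, ξ 0 ω ∂P →
          xhat = g.A *ᵥ xhat + g.B *ᵥ (F *ᵥ xhat + G *ᵥ yhat + H) + ∫ ω, w 0 0 ω ∂P →
          ∫ ω, x₀ 0 ω ∂P = xhat →
          ∀ s : ℕ → LQ.Strategy nx nu ny,
            (∀ i, s i = LQ.affineStrategy ny F (G *ᵥ yhat + H)) →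
            g.IsSEBEU P x₀ w ξ s ∧
            iIndepFun (g.randomEnv x₀ w ξ s) P ∧
            (∀ t, IdentDistrib (g.randomEnv x₀ w ξ s t) (g.randomEnv x₀ w ξ s 0) P P) ∧
            (∀ t, MemLp (g.randomEnv x₀ w ξ s t) 2 P) ∧
            ∀ t, ∫ ω, g.randomEnv x₀ w ξ s t ω ∂P = yhat := by
  refine ⟨LQ.Game.existsUnique_isRiccatiSolution hQ hR hβ₀ hβ₁ hAB, fun M hM =>
    ⟨(hM.hasSum_Gseq hQ hR hβ₀ hβ₁).summable, hM.isUnit_one_sub_Γ hQ hR hβ₀ hβ₁, ?_⟩⟩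
  intro F G H hF hG hH yhat xhat hy hx hx₀ s hs
  obtain rfl : s = fun _ => LQ.affineStrategy ny F (G *ᵥ yhat + H) := funext hs
  set h : LQ.Vec nu := G *ᵥ yhat + H with hh
  set c : LQ.Vec ny := g.E1 *ᵥ (F *ᵥ xhat + h) + g.E2 *ᵥ xhat with hc
  have hx' : xhat = g.A *ᵥ xhat + g.B *ᵥ (F *ᵥ xhat + h) + ∫ ω, w 0 0 ω ∂P := by
    rw [hh, ← add_assoc]
    exact hx
  -- Consistency: the equation for `yhat` says exactly that the limiting average `c` plus the mean
  -- noise is the mean used in the feedback.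
  have hyc : yhat = c + ∫ ω, ξ 0 ω ∂P := by
    rw [hc, hh]
    conv_lhs => rw [hy]
    simp only [Matrix.add_mulVec, Matrix.mulVec_add, Matrix.mulVec_mulVec]
    abel
  have hξi : ∀ t, Integrable (ξ t) P := fun t => (hprim.memLp_ξ t).integrable one_le_two
  have hmean : ∀ t, ∫ ω, c + ξ t ω ∂P = yhat := fun t => by
    rw [integral_add (integrable_const c) (hξi t), integral_const, probReal_univ, one_smul,
      (hprim.ident_ξ t).integral_eq, ← hyc]
  have henv := hprim.randomEnv_ae_eq F h g hx' hx₀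
  have henv' : ∀ t, g.randomEnv x₀ w ξ (fun _ => LQ.affineStrategy ny F h) t =ᵐ[P]
      fun ω => c + ξ t ω := fun t => henv.mono fun ω hω => hω t
  have hm : Measurable fun ω t => c + ξ t ω :=
    measurable_pi_lambda _ fun t => (hprim.measurable_ξ t).const_add c
  -- The belief is taken in the form `c + ξ`, which is visibly measurable; the generated environment
  -- agrees with it outside a null set common to all times.
  have hlaw : (P.map fun ω t => g.randomEnv x₀ w ξ (fun _ => LQ.affineStrategy ny F h) t ω) =
      P.map fun ω t => c + ξ t ω :=
    Measure.map_congr (henv.mono fun ω hω => funext hω)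
  have hprob : IsProbabilityMeasure (P.map fun ω t => c + ξ t ω) :=
    Measure.isProbabilityMeasure_map hm.aemeasurable
  refine ⟨⟨hprim.envDefined_affineStrategy F h g hx' hx₀, fun _ => P.map fun ω t => c + ξ t ω,
    fun _ => hprob, fun i s' => (hprim.playerAssumption c i).costDefined hQ hR hβ₀ hβ₁ s',
    fun i s' => ?_, fun _ => hlaw.symm⟩, ?_, fun t => ?_, fun t => ?_, fun t => ?_⟩
  · have hz : ∫ z : ℕ → LQ.Vec ny, z 0 ∂(P.map fun ω t => c + ξ t ω) = yhat := by
      rw [integral_map hm.aemeasurable (measurable_pi_apply 0).aestronglyMeasurable]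
      exact hmean 0
    have hopt := (hprim.playerAssumption c i).believedCost_affineStrategy_le_believedCost
      hQ hR hβ₀ hβ₁ hM s'
    rw [hz, (hprim.ident_w i 0).integral_eq, ← hF, ← hG, ← hH] at hopt
    exact hopt
  · exact (hprim.iIndepFun_ξ.comp (fun _ y => c + y) fun _ => measurable_const_add c).congr
      fun t => (henv' t).symm
  · have h1 : ∀ t, IdentDistrib (g.randomEnv x₀ w ξ (fun _ => LQ.affineStrategy ny F h) t)
        (fun ω => c + ξ t ω) P P := fun t =>
      (IdentDistrib.of_ae_eq ((hprim.measurable_ξ t).const_add c).aemeasurable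
        (henv' t).symm).symm
    exact (h1 t).trans (((hprim.ident_ξ t).comp (measurable_const_add c)).trans (h1 0).symm)
  · exact ((memLp_const c).add (hprim.memLp_ξ t)).ae_eq (henv' t).symm
  · exact (integral_congr_ae (henv' t)).trans (hmean t)
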